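/- Let $K$ be an arbitrary infinite field, $R=K[x,y,z]$, and let $Z\subset\mathbb P^2_K$ be a reduced scheme consisting of finitely many distinct ($K$-rational) points, with homogeneous ideal $I_Z\subset R$. For a homogeneous ideal $I$ let $[I]_d$ be its component of degree $d$, let $\dim$ denote dimension over $K$, and let $h_Z(d)=\dim [R/I_Z]_d$ be the Hilbert function of $Z$. For a point $P\in\mathbb P^2_K$ with ideal $I_P$ and an integer $j\ge 0$ let $I_{Z+jP}=I_P^{\,j}\cap I_Z$. A statement holds for a general point $P$ if it holds for all $K$-rational points $P$ of some nonempty Zariski open subset of $\mathbb P^2_K$. Define \[ t_Z=\min\Big\{j\ge 0 : \dim[I_Z]_{j+1}>\tbinom{j+1}{2}\Big\},\qquad m_Z=\min\big\{j\ge 0 : \dim[I_{Z+jP}]_{j+1}>0 \text{ for a general point } P\big\}. \] Say that $Z$ admits an unexpected curve if there is an integer $j>0$ such that, for a general point $P$, \[ \dim[I_{Z+jP}]_{j+1}>\max\Big\{\dim[I_Z]_{j+1}-\tbinom{j+1}{2},\,0\Big\}. \] **Theorem.** Suppose that $h_Z(t_Z)<|Z|$. Then \[ m_Z=t_Z<\frac{|Z|-1}{2},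 \] and for a general point $P$ one has $\dim[I_{Z+m_ZP}]_{m_Z+1}=1$ and \[ \dim[I_{Z+jP}]_{j+1}=\dim[I_Z]_{j+1}-\binom{j+1}{2}\qquad\text{for all } j\ge m_Z . \] Consequently, $Z$ admits no unexpected curves. -/

import Mathlib

open scoped LinearAlgebra.Projectivization

noncomputable section

namespace UnexpectedCurves

variable {K : Type*} [Field K]

/-- The projective plane over `K`, as its set of `K`-rational points. -/
abbrev Plane (K : Type*) [Field K] : Type _ := ℙ K (Fin 3 → K)

/-- The homogeneous ideal `I_P ⊆ K[x, y, z]` of a point `P` of the plane: the polynomials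
vanishing on the line through the origin of `K³` that represents `P`. Over an infinite field this
is the ideal generated by the forms vanishing at `P`. -/
def pointIdeal (P : Plane K) : Ideal (MvPolynomial (Fin 3) K) :=
  MvPolynomial.vanishingIdeal K (P.submodule : Set (Fin 3 → K))

/-- The homogeneous ideal `I_Z` of a finite reduced set of points `Z`. -/
def pointsIdeal (Z : Finset (Plane K)) : Ideal (MvPolynomial (Fin 3) K) :=
  ⨅ P ∈ Z, pointIdeal P

/-- The ideal `I_{Z + jP} = I_P ^ j ∩ I_Z`. -/
def fatIdeal (Z : Finset (Plane K)) (j : ℕ) (P : Plane K) : Ideal (MvPolynomial (Fin 3) K) :=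
  pointIdeal P ^ j ⊓ pointsIdeal Z

/-- `dim_K [I]_d`, the dimension of the space of forms of degree `d` in the ideal `I`. -/
def dimDeg (I : Ideal (MvPolynomial (Fin 3) K)) (d : ℕ) : ℕ :=
  Module.finrank K ↥(MvPolynomial.homogeneousSubmodule (Fin 3) K d ⊓ I.restrictScalars K)

/-- The Hilbert function `h_Z(d) = dim_K [R / I_Z]_d` where `R = K[x, y, z]`; here `[R / I_Z]_d`
is the image of the space of forms of degree `d` in `R / I_Z`. -/
def hilbertFn (Z : Finset (Plane K)) (d : ℕ) : ℕ :=
  Module.finrank K ↥((MvPolynomial.homogeneousSubmodule (Fin 3) K d).map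
    (Ideal.Quotient.mkₐ K (pointsIdeal Z)).toLinearMap)

/-- Zariski open sets of the plane: the complements of the zero loci of sets of forms. (Whether a
form vanishes at a point does not depend on the chosen representative.) -/
def IsZariskiOpen (U : Set (Plane K)) : Prop :=
  ∃ S : Set (MvPolynomial (Fin 3) K), (∀ f ∈ S, ∃ n : ℕ, f.IsHomogeneous n) ∧
    U = {P | ∃ f ∈ S, MvPolynomial.eval P.rep f ≠ 0}

/-- A property holds for a general point `P` of the plane if it holds for all points of some
non-empty Zariski open set. -/
def ForGeneral (p : Plane K → Prop) : Prop :=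
  ∃ U : Set (Plane K), IsZariskiOpen U ∧ U.Nonempty ∧ ∀ P ∈ U, p P

/-- The invariant `t_Z`: the least `j` with `dim [I_Z]_{j+1} > binom(j+1, 2)`. -/
def tIndex (Z : Finset (Plane K)) : ℕ :=
  sInf {j : ℕ | (j + 1).choose 2 < dimDeg (pointsIdeal Z) (j + 1)}

/-- The multiplicity index `m_Z`: the least `j` such that `dim [I_{Z+jP}]_{j+1} > 0` for a general
point `P`. -/
def multIndex (Z : Finset (Plane K)) : ℕ :=
  sInf {j : ℕ | ForGeneral fun P : Plane K => 0 < dimDeg (fatIdeal Z j P) (j + 1)}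

/-- `Z` admits an unexpected curve (of degree `j + 1`, for some `j > 0`): for a general point `P`
one has `dim [I_{Z+jP}]_{j+1} > max (dim [I_Z]_{j+1} - binom(j+1, 2), 0)`. -/
def AdmitsUnexpectedCurve (Z : Finset (Plane K)) : Prop :=
  ∃ j : ℕ, 0 < j ∧ ForGeneral fun P : Plane K =>
    max ((dimDeg (pointsIdeal Z) (j + 1) : ℤ) - ((j + 1).choose 2 : ℤ)) 0 <
      (dimDeg (fatIdeal Z j P) (j + 1) : ℤ)

end UnexpectedCurves

end

/-!
Project from the point `P`. In coordinates with `P = (0 : 0 : 1)` and the points of `Z` in the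
chart `x ≠ 0`, the points become `(y i, z i)` with distinct `y i`, the value `h(d)` of the Hilbert
function is the rank of the space `evalSpan y z d` of functions of degree at most `d` on them, and
`[I_P ^ j]_{j + 1}` consists of the forms `A(y) z + B(y)` with `deg A ≤ j` and `deg B ≤ j + 1`
(`pencilEval`, `range_pencilForm`). Write `t` for `t_Z`.

*Numerical part.* Since `dim [I_Z]_{j + 1} > binom(j + 1, 2)` means `h(j + 1) ≤ 2 j + 2`, the
definition of `t` gives `h(t) ≥ 2 t + 1` and `h(t + 1) ≤ 2 t + 2`. The Hilbert function grows
strictly until it reaches `|Z|`, so `h(t) < |Z|` forces `h(t) = 2 t + 1` and `h(t + 1) = 2 t + 2`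
(`finrank_evalSpan_eq`), and `|Z| ≥ 2 t + 2`.

*No curve of degree `t` through `Z` has multiplicity `t - 1` at `P`* (`pencil_eq_zero`). As
`h(t) < |Z|`, some subset `s` of `Z` with at most `2 t + 2` points has the Cayley-Bacharach property
in degree `t`: forms of degree `t` vanishing at all of its points but one vanish at all of them.
Suppose the curve exists, and let `A z + B` be a curve of least degree `k + 1` through `s` with
multiplicity `k` at `P`, so that `k < t`. The Cayley-Bacharach property allows common factors of `A`
and `B` to be removed, so `A` and `B` are coprime and the curve is rational, with parameter `y`.
Curves of degree `t` with multiplicity at least `k - 1` at `P` cut out on it a complete linear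
system (`exists_evalSpan_of_isCoprime`), of degree `t (k + 1) - k (k - 1)`. For `2 ≤ k < t` this is at
least `2 t + 1 ≥ |s| - 1`, so that the points of `s` can be separated: a contradiction. For `k = 1` it
leaves only `|s| = 2 t + 2 ≥ 6` points on an irreducible conic through `P`, while for general `P`
some conic through `s` avoids `P`. For `k = 0` at least `t + 2` points lie on a line; then the curve
contains the line, the remaining factor contains at most `t - 1` lines through `P`, and
`h(t) ≤ 2 t`.

*From degree `t + 1` on, the forms `A z + B` and `I_Z` span all forms* (`range_pencilEval_eq`). In
degree `t ≥ 2` this holds by the previous step, both sides having rank `2 t + 1` on `Z`, and it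
propagates: `z² A` is a combination of functions of degree `d` and of `y` times such functions. For
`t ≤ 1` one starts from a conic through `Z` avoiding `P`. Hence
`dim [I_{Z + jP}]_{j + 1} = dim [I_Z]_{j + 1} - binom(j + 1, 2)` for `j ≥ t`, while the dimension
is zero for `j < t`.

The conditions on `P` used here are collected in `GeneralPosition`; they exclude finitely many
curves. Everything else follows, since nonempty open subsets of the plane meet.
-/

noncomputable section

namespace UnexpectedCurves

/-! ### Functions of bounded degree on points of the affine plane -/

section Affine

open Polynomial

variable {K ι : Type*} [Field K]

/-- The functions on the points `(y i, z i)` of the affine plane that are given by polynomials of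
total degree at most `d`. -/
def evalSpan (y z : ι → K) (d : ℕ) : Submodule K (ι → K) :=
  Submodule.span K {e | ∃ a b : ℕ, a + b ≤ d ∧ e = fun i => y i ^ a * z i ^ b}

/-- The values at the points `(y i, z i)` of the polynomials `A(y) z + B(y)` with `deg A < d` and
`deg B < d + 1`. These are the dehomogenized forms of degree `d` whose multiplicity at the point at
infinity of the `z`-axis is at least `d - 1`. -/
def pencilEval (y z : ι → K) (d : ℕ) :
    (degreeLT K d × degreeLT K (d + 1)) →ₗ[K] (ι → K) where
  toFun p i := (p.1 : K[X]).eval (y i) * z i + (p.2 : K[X]).eval (y i)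
  map_add' p q := by
    ext i
    simp only [Prod.fst_add, Prod.snd_add, Submodule.coe_add, eval_add, Pi.add_apply]
    ring
  map_smul' c p := by
    ext i
    simp only [Prod.smul_fst, Prod.smul_snd, Submodule.coe_smul, eval_smul, smul_eq_mul,
      RingHom.id_apply, Pi.smul_apply]
    ring

theorem mem_evalSpan_monomial (y z : ι → K) {a b d : ℕ} (h : a + b ≤ d) :
    (fun i => y i ^ a * z i ^ b) ∈ evalSpan y z d :=
  Submodule.subset_span ⟨a, b, h, rfl⟩

theorem evalSpan_mono (y z : ι → K) {d d' : ℕ} (h : d ≤ d') : evalSpan y z d ≤ evalSpan y z d' :=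
  Submodule.span_mono fun _ ⟨a, b, hab, he⟩ => ⟨a, b, hab.trans h, he⟩

theorem eval_mul_pow_mem_evalSpan (y z : ι → K) {C : K[X]} {b d : ℕ} (h : C.natDegree + b ≤ d) :
    (fun i => C.eval (y i) * z i ^ b) ∈ evalSpan y z d := by
  have : (fun i => C.eval (y i) * z i ^ b) =
      ∑ a ∈ Finset.range (C.natDegree + 1), C.coeff a • fun i => y i ^ a * z i ^ b := by
    ext i
    simp [eval_eq_sum_range, Finset.sum_mul, mul_assoc]
  rw [this]
  refine Submodule.sum_mem _ fun a ha => Submodule.smul_mem _ _ (mem_evalSpan_monomial y z ?_)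
  have := Finset.mem_range.1 ha
  omega

theorem eval_mem_evalSpan (y z : ι → K) {C : K[X]} {d : ℕ} (h : C.natDegree ≤ d) :
    (fun i => C.eval (y i)) ∈ evalSpan y z d := by
  simpa using eval_mul_pow_mem_evalSpan y z (C := C) (b := 0) (d := d) (by omega)

theorem mul_mem_evalSpan_succ (y z : ι → K) {w : ι → K}
    (hw : ∀ a b d : ℕ, a + b ≤ d →
      (fun i => w i * (y i ^ a * z i ^ b)) ∈ evalSpan y z (d + 1)) {d : ℕ} {e : ι → K}
    (he : e ∈ evalSpan y z d) : (fun i => w i * e i) ∈ evalSpan y z (d + 1) := by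
  have : evalSpan y z d ≤ (evalSpan y z (d + 1)).comap (LinearMap.mulLeft K w) := by
    refine Submodule.span_le.2 ?_
    rintro _ ⟨a, b, hab, rfl⟩
    exact hw a b d hab
  exact this he

theorem y_mul_mem_evalSpan (y z : ι → K) {d : ℕ} {e : ι → K} (he : e ∈ evalSpan y z d) :
    (fun i => y i * e i) ∈ evalSpan y z (d + 1) := by
  refine mul_mem_evalSpan_succ y z (fun a b d h => ?_) he
  convert mem_evalSpan_monomial y z (a := a + 1) (b := b) (d := d + 1) (by omega) using 2
  ring

theorem z_mul_mem_evalSpan (y z : ι → K) {d : ℕ} {e : ι → K} (he : e ∈ evalSpan y z d) :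
    (fun i => z i * e i) ∈ evalSpan y z (d + 1) := by
  refine mul_mem_evalSpan_succ y z (fun a b d h => ?_) he
  convert mem_evalSpan_monomial y z (a := a) (b := b + 1) (d := d + 1) (by omega) using 2
  ring

/-- The functions of degree at most `d + 1` are spanned by those of degree at most `d` and their
products with the two coordinate functions. -/
theorem evalSpan_succ_le (y z : ι → K) {d : ℕ} {U : Submodule K (ι → K)}
    (h1 : evalSpan y z d ≤ U) (hy : ∀ e ∈ evalSpan y z d, (fun i => y i * e i) ∈ U)
    (hz : ∀ e ∈ evalSpan y z d, (fun i => z i * e i) ∈ U) : evalSpan y z (d + 1) ≤ U := by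
  refine Submodule.span_le.2 ?_
  rintro _ ⟨a, b, hab, rfl⟩
  rcases a with _ | a
  · rcases b with _ | b
    · exact h1 (mem_evalSpan_monomial y z (by omega))
    · have := hz _ (mem_evalSpan_monomial y z (a := 0) (b := b) (by omega))
      simpa [pow_succ', mul_left_comm] using this
  · have := hy _ (mem_evalSpan_monomial y z (a := a) (b := b) (by omega))
    simpa [pow_succ', mul_assoc] using this

theorem range_pencilEval_le (y z : ι → K) (d : ℕ) :
    LinearMap.range (pencilEval y z d) ≤ evalSpan y z d := by
  rintro _ ⟨⟨⟨A, hA⟩, ⟨B, hB⟩⟩, rfl⟩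
  have hB' : (fun i => B.eval (y i)) ∈ evalSpan y z d := by
    refine eval_mem_evalSpan y z ?_
    have := mem_degreeLT.1 hB
    rcases eq_or_ne B 0 with rfl | h0
    · simp
    · have := (natDegree_lt_iff_degree_lt h0).2 this
      omega
  have hA' : (fun i => A.eval (y i) * z i) ∈ evalSpan y z d := by
    rcases eq_or_ne A 0 with rfl | h0
    · simp only [eval_zero, zero_mul]
      exact Submodule.zero_mem _
    · have := (natDegree_lt_iff_degree_lt h0).2 (mem_degreeLT.1 hA)
      simpa using eval_mul_pow_mem_evalSpan y z (C := A) (b := 1) (d := d) (by omega)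
  exact Submodule.add_mem _ hA' hB'

theorem pencil_mem_range (y z : ι → K) {d : ℕ} {A B : K[X]} (hA : A.degree < d)
    (hB : B.degree < (d + 1 : ℕ)) :
    (fun i => A.eval (y i) * z i + B.eval (y i)) ∈ LinearMap.range (pencilEval y z d) :=
  ⟨⟨⟨A, mem_degreeLT.2 hA⟩, ⟨B, mem_degreeLT.2 hB⟩⟩, rfl⟩

theorem finrank_degreeLT_prod (d : ℕ) :
    Module.finrank K (degreeLT K d × degreeLT K (d + 1)) = 2 * d + 1 := by
  rw [Module.finrank_prod, (degreeLTEquiv K d).finrank_eq, (degreeLTEquiv K (d + 1)).finrank_eq]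
  simp
  omega

instance (d : ℕ) : FiniteDimensional K (degreeLT K d) :=
  (degreeLTEquiv K d).symm.finiteDimensional

/-- The curve `A(y) z + B(y) = 0` is rational, and the forms of degree `m + l` cut out on it, away
from its multiple point, a complete linear system: every polynomial `T` in the parameter `y` of
degree at most `(l + 1) * m + m + l` is, up to the factor `A ^ m`, the restriction to the curve of a
function of degree at most `m + l`. -/
theorem exists_evalSpan_of_isCoprime (y z : ι → K) {A B : K[X]} (hAB : IsCoprime A B) {l : ℕ}
    (hA : A.natDegree ≤ l + 1) (hB : B.natDegree ≤ l + 2)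
    (hmax : A.natDegree = l + 1 ∨ B.natDegree = l + 2) (m : ℕ) :
    ∀ T : K[X], T.natDegree ≤ (l + 1) * m + m + l → ∃ e ∈ evalSpan y z (m + l),
      ∀ i, A.eval (y i) * z i + B.eval (y i) = 0 → T.eval (y i) = A.eval (y i) ^ m * e i := by
  induction m with
  | zero =>
    intro T hT
    exact ⟨_, eval_mem_evalSpan y z (C := T) (by omega), by simp⟩
  | succ m ih =>
    intro T hT
    obtain ⟨C, T', hC, hT', hsum⟩ : ∃ C T' : K[X], C.natDegree ≤ m + 1 + l ∧
        T'.natDegree ≤ (l + 1) * m + m + l ∧ T = A ^ (m + 1) * C + B * T' := by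
      obtain ⟨u, v, huv⟩ := hAB.pow_left (m := m + 1)
      have hpow : (A ^ (m + 1)).natDegree ≤ (l + 1) * m + l + 1 :=
        (natDegree_pow_le).trans <| by
          calc (m + 1) * A.natDegree ≤ (m + 1) * (l + 1) := Nat.mul_le_mul_left _ hA
            _ = (l + 1) * m + l + 1 := by ring
      rw [Nat.mul_succ] at hT
      rcases hmax with hmax | hmax
      · -- reduce the coefficient of `B` modulo `A ^ (m + 1)`
        have hA0 : A ≠ 0 := by rintro rfl; simp at hmax
        have hpow' : (A ^ (m + 1)).natDegree = (l + 1) * m + l + 1 := by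
          rw [natDegree_pow, hmax]; ring
        set T' := (v * T) % A ^ (m + 1)
        have hT' : T'.natDegree ≤ (l + 1) * m + l := by
          have : T'.natDegree < _ := natDegree_mod_lt (v * T) (q := A ^ (m + 1)) (by omega)
          omega
        obtain ⟨C, hC⟩ : A ^ (m + 1) ∣ T - B * T' := by
          have h1 := EuclideanDomain.div_add_mod (v * T) (A ^ (m + 1))
          refine ⟨u * T + B * (v * T / A ^ (m + 1)), ?_⟩
          change T - B * ((v * T) % A ^ (m + 1)) = _
          linear_combination (-T) * huv - B * h1
        refine ⟨C, T', ?_, by omega, by linear_combination hC⟩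
        rcases eq_or_ne C 0 with rfl | hC0
        · simp
        · have h2 : (T - B * T').natDegree = (A ^ (m + 1)).natDegree + C.natDegree := by
            rw [hC, natDegree_mul (pow_ne_zero _ hA0) hC0]
          have h3 : (B * T').natDegree ≤ (l + 2) + ((l + 1) * m + l) :=
            natDegree_mul_le.trans (add_le_add hB hT')
          have h4 := natDegree_sub_le T (B * T')
          have h5 := le_max_iff.1 h4
          omega
      · -- reduce the coefficient of `A ^ (m + 1)` modulo `B`
        have hB0 : B ≠ 0 := by rintro rfl; simp at hmax
        set C := (u * T) % B
        have hC : C.natDegree ≤ l + 1 := by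
          have : C.natDegree < _ := natDegree_mod_lt (u * T) (q := B) (by omega)
          omega
        obtain ⟨T', hT'⟩ : B ∣ T - A ^ (m + 1) * C := by
          have h1 := EuclideanDomain.div_add_mod (u * T) B
          refine ⟨v * T + A ^ (m + 1) * (u * T / B), ?_⟩
          change T - A ^ (m + 1) * ((u * T) % B) = _
          linear_combination (-T) * huv - A ^ (m + 1) * h1
        refine ⟨C, T', by omega, ?_, by linear_combination hT'⟩
        rcases eq_or_ne T' 0 with rfl | hT0
        · simp
        · have h2 : (T - A ^ (m + 1) * C).natDegree = B.natDegree + T'.natDegree := by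
            rw [hT', natDegree_mul hB0 hT0]
          have h3 : (A ^ (m + 1) * C).natDegree ≤ ((l + 1) * m + l + 1) + (l + 1) :=
            natDegree_mul_le.trans (add_le_add hpow hC)
          have h4 := natDegree_sub_le T (A ^ (m + 1) * C)
          have h5 := le_max_iff.1 h4
          omega
    obtain ⟨e, he, hTe⟩ := ih T' hT'
    refine ⟨(fun i => C.eval (y i)) - fun i => z i * e i,
      Submodule.sub_mem _ (eval_mem_evalSpan y z hC) ?_, fun i hi => ?_⟩
    · have := z_mul_mem_evalSpan y z he
      rwa [show m + l + 1 = m + 1 + l by omega] at this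
    · simp only [hsum, eval_add, eval_mul, eval_pow, hTe i hi, Pi.sub_apply]
      linear_combination (A.eval (y i) ^ m * e i) * hi

end Affine

/-! ### Circuits and growth of the Hilbert function -/

section Circuit

open Polynomial

variable {K ι : Type*} [Field K]

theorem card_le_finrank_of_separated [Finite ι] {E : Submodule K (ι → K)} {s : Finset ι}
    (hs : ∀ i ∈ s, ∃ e ∈ E, e i ≠ 0 ∧ ∀ j ∈ s, j ≠ i → e j = 0) :
    s.card ≤ Module.finrank K E := by
  choose! e heE hei hej using hs
  have hli : LinearIndependent K (fun i : s => (⟨e i, heE i i.2⟩ : E)) := by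
    rw [Fintype.linearIndependent_iff]
    intro g hg i
    have h1 := congrFun (congrArg Subtype.val hg) (i : ι)
    simp only [Submodule.coe_sum, Submodule.coe_smul, Finset.sum_apply, Pi.smul_apply,
      smul_eq_mul, ZeroMemClass.coe_zero, Pi.zero_apply] at h1
    rw [Finset.sum_eq_single i] at h1
    · exact (mul_eq_zero.1 h1).resolve_right (hei i i.2)
    · intro j _ hji
      rw [hej j j.2 i i.2 (fun h => hji (Subtype.ext h.symm)), mul_zero]
    · simp
  simpa using hli.fintype_card_le_finrank

/-- A linear system that does not separate all the points has a circuit: a set of points on which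
every member vanishing at all points but one vanishes at that one too (the Cayley-Bacharach
property), minimal and therefore of size at most the rank plus one. -/
theorem exists_circuit [Fintype ι] {E : Submodule K (ι → K)}
    (hE : Module.finrank K E < Fintype.card ι) :
    ∃ s : Finset ι, s.Nonempty ∧ s.card ≤ Module.finrank K E + 1 ∧
      ∀ i ∈ s, ∀ e ∈ E, (∀ j ∈ s, j ≠ i → e j = 0) → e i = 0 := by
  classical
  let P : Finset ι → Prop := fun s => ∀ i ∈ s, ∃ e ∈ E, e i ≠ 0 ∧ ∀ j ∈ s, j ≠ i → e j = 0
  have huniv : ¬ P Finset.univ := fun h =>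
    absurd (card_le_finrank_of_separated h) (by simpa using hE)
  obtain ⟨s, hs⟩ := exists_minimal_of_wellFoundedLT (fun s => ¬ P s) ⟨_, huniv⟩
  have herase : ∀ i ∈ s, P (s.erase i) := fun i hi =>
    not_not.1 (hs.not_prop_of_lt (Finset.erase_ssubset hi))
  obtain ⟨i₀, hi₀, hi₀s⟩ : ∃ i₀ ∈ s, ∀ e ∈ E, (∀ j ∈ s, j ≠ i₀ → e j = 0) → e i₀ = 0 := by
    by_contra! hcon
    refine hs.prop fun i hi => ?_
    obtain ⟨e, he, h1, h2⟩ := hcon i hi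
    exact ⟨e, he, h2, h1⟩
  refine ⟨s, ⟨i₀, hi₀⟩, ?_, fun i hi e he hei => ?_⟩
  · have := card_le_finrank_of_separated (herase i₀ hi₀)
    rw [Finset.card_erase_of_mem hi₀] at this
    omega
  · by_contra hne
    rcases eq_or_ne i i₀ with rfl | hii
    · exact hne (hi₀s e he hei)
    -- correct a function separating `i₀` from the rest of `s.erase i` by a multiple of `e`
    obtain ⟨g, hg, hg0, hgj⟩ := herase i hi i₀ (Finset.mem_erase.2 ⟨hii.symm, hi₀⟩)
    have he0 : e i₀ = 0 := hei i₀ hi₀ hii.symm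
    have := hi₀s (g - (g i / e i) • e) (Submodule.sub_mem _ hg (Submodule.smul_mem _ _ he))
      fun j hj hj0 => by
        rcases eq_or_ne j i with rfl | hji
        · simp [div_mul_cancel₀ _ hne]
        · simp [hgj j (Finset.mem_erase.2 ⟨hji, hj⟩) hj0, hei j hj hji]
    simp [he0] at this
    exact hg0 this

/-- The Hilbert function of points with distinct parameters `y i` is strictly increasing until it
reaches the number of points. -/
theorem finrank_evalSpan_lt_succ [Fintype ι] {y : ι → K} (hy : Function.Injective y) (z : ι → K)
    {d : ℕ} (hd : Module.finrank K (evalSpan y z d) < Fintype.card ι) :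
    Module.finrank K (evalSpan y z d) < Module.finrank K (evalSpan y z (d + 1)) := by
  classical
  refine Submodule.finrank_lt_finrank_of_lt (lt_of_le_of_ne (evalSpan_mono y z d.le_succ) ?_)
  intro heq
  -- otherwise the space is stable under multiplication by `y` and contains all polynomials in `y`
  have hpow : ∀ a : ℕ, (fun i => y i ^ a) ∈ evalSpan y z d := by
    intro a
    induction a with
    | zero => simpa using mem_evalSpan_monomial y z (a := 0) (b := 0) (d := d) (by omega)
    | succ a ih =>
      rw [heq]
      simpa [pow_succ'] using y_mul_mem_evalSpan y z ih
  have hpoly : ∀ p : K[X], (fun i => p.eval (y i)) ∈ evalSpan y z d := by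
    intro p
    have : (fun i => p.eval (y i)) =
        ∑ a ∈ Finset.range (p.natDegree + 1), p.coeff a • fun i => y i ^ a := by
      ext i
      simp [eval_eq_sum_range]
    rw [this]
    exact Submodule.sum_mem _ fun a _ => Submodule.smul_mem _ _ (hpow a)
  have htop : evalSpan y z d = ⊤ := by
    refine eq_top_iff.2 fun f _ => ?_
    convert hpoly (Lagrange.interpolate Finset.univ y f) using 1
    ext i
    exact (Lagrange.eval_interpolate_at_node f hy.injOn (Finset.mem_univ i)).symm
  rw [htop, finrank_top, Module.finrank_fintype_fun_eq_card] at hd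
  exact lt_irrefl _ hd

theorem finrank_evalSpan_zero [Fintype ι] [Nonempty ι] (y z : ι → K) :
    1 ≤ Module.finrank K (evalSpan y z 0) := by
  refine Module.finrank_pos_iff_exists_ne_zero.2
    ⟨⟨_, mem_evalSpan_monomial y z (a := 0) (b := 0) le_rfl⟩, fun h => ?_⟩
  have := congrFun (congrArg Subtype.val h) (Classical.arbitrary ι)
  simp at this

end Circuit

/-! ### Rational curves through points with the Cayley-Bacharach property -/

section Pencil

open Polynomial

variable {K ι : Type*} [Field K]

/-- A nonzero polynomial `A(y) z + B(y)` of least degree vanishing on a set of points with the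
Cayley-Bacharach property has coprime coefficients: a linear factor through a point of the set could
be removed by the Cayley-Bacharach property, and any other common factor for trivial reasons. -/
theorem isCoprime_of_minimal {y : ι → K} (hy : Function.Injective y) (z : ι → K) {t k : ℕ}
    (hk : k < t) {s : Finset ι} (hs : s.Nonempty)
    (hCB : ∀ i ∈ s, ∀ e ∈ evalSpan y z t, (∀ j ∈ s, j ≠ i → e j = 0) → e i = 0)
    {A B : K[X]} (hne : A ≠ 0 ∨ B ≠ 0) (hA : A.natDegree ≤ k) (hB : B.natDegree ≤ k + 1)
    (hAB : ∀ i ∈ s, A.eval (y i) * z i + B.eval (y i) = 0)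
    (hmin : ∀ l < k, ∀ A' B' : K[X], A'.natDegree ≤ l → B'.natDegree ≤ l + 1 →
      (∀ i ∈ s, A'.eval (y i) * z i + B'.eval (y i) = 0) → A' = 0 ∧ B' = 0) :
    IsCoprime A B := by
  classical
  obtain ⟨i₁, hi₁⟩ := hs
  -- a common factor cannot be divided out
  have hdiv : ∀ p A' B' : K[X], A = p * A' → B = p * B' → 1 ≤ p.natDegree →
      ¬ ∀ i ∈ s, A'.eval (y i) * z i + B'.eval (y i) = 0 := by
    rintro p A' B' hA' hB' hp hvan
    have hp0 : p ≠ 0 := by rintro rfl; simp at hp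
    have hdA : A' = 0 ∨ A'.natDegree + 1 ≤ k := by
      refine or_iff_not_imp_left.2 fun h => ?_
      rw [hA', natDegree_mul hp0 h] at hA
      omega
    have hdB : B'.natDegree ≤ k := by
      rcases eq_or_ne B' 0 with rfl | h
      · simp
      · rw [hB', natDegree_mul hp0 h] at hB
        omega
    have hzero : A' = 0 ∧ B' = 0 := by
      rcases k with _ | k
      · have h0 : A' = 0 := hdA.resolve_right (by omega)
        refine ⟨h0, ?_⟩
        have h1 := hvan i₁ hi₁
        rw [eq_C_of_natDegree_le_zero hdB, h0] at h1
        rw [eq_C_of_natDegree_le_zero hdB]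
        simpa using h1
      · refine hmin k k.lt_succ_self A' B' ?_ hdB hvan
        rcases hdA with rfl | h
        · simp
        · omega
    rw [hA', hB', hzero.1, hzero.2] at hne
    simp at hne
  by_cases hcom : ∃ i ∈ s, A.eval (y i) = 0 ∧ B.eval (y i) = 0
  · exfalso
    obtain ⟨i, hi, hAi, hBi⟩ := hcom
    obtain ⟨A', hA'⟩ := dvd_iff_isRoot.2 hAi
    obtain ⟨B', hB'⟩ := dvd_iff_isRoot.2 hBi
    refine hdiv _ A' B' hA' hB' (by simp) ?_
    have hother : ∀ j ∈ s, j ≠ i → A'.eval (y j) * z j + B'.eval (y j) = 0 := by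
      intro j hj hji
      have h1 := hAB j hj
      rw [hA', hB'] at h1
      simp only [eval_mul, eval_sub, eval_X, eval_C] at h1
      have h2 : y j - y i ≠ 0 := sub_ne_zero.2 fun h => hji (hy h)
      exact (mul_eq_zero.1 (show (y j - y i) * (A'.eval (y j) * z j + B'.eval (y j)) = 0 by
        linear_combination h1)).resolve_left h2
    have hX : ∀ Q : K[X], Q = 0 ∨ ((X - C (y i)) * Q).natDegree = Q.natDegree + 1 := by
      intro Q
      refine or_iff_not_imp_left.2 fun h => ?_
      rw [natDegree_mul (X_sub_C_ne_zero _) h, natDegree_X_sub_C, add_comm]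
    have hmem : (fun j => A'.eval (y j) * z j + B'.eval (y j)) ∈ evalSpan y z t := by
      refine Submodule.add_mem _ ?_ (eval_mem_evalSpan y z ?_)
      · have : A'.natDegree + 1 ≤ t := by
          rcases hX A' with rfl | h
          · simp; omega
          · rw [← hA'] at h; omega
        simpa using eval_mul_pow_mem_evalSpan y z (C := A') (b := 1) this
      · rcases hX B' with rfl | h
        · simp
        · rw [← hB'] at h; omega
    intro j hj
    rcases eq_or_ne j i with rfl | hji
    · exact hCB j hi _ hmem hother
    · exact hother j hj hji
  · by_contra hcop
    obtain ⟨A', hA'⟩ := EuclideanDomain.gcd_dvd_left A B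
    obtain ⟨B', hB'⟩ := EuclideanDomain.gcd_dvd_right A B
    have hg0 : EuclideanDomain.gcd A B ≠ 0 := by
      rw [Ne, EuclideanDomain.gcd_eq_zero_iff]
      tauto
    have hgdeg : 1 ≤ (EuclideanDomain.gcd A B).natDegree := by
      by_contra hlt
      refine hcop (EuclideanDomain.gcd_isUnit_iff.1 ?_)
      rw [isUnit_iff_degree_eq_zero, degree_eq_natDegree hg0]
      norm_cast
      omega
    refine hdiv _ A' B' hA' hB' hgdeg fun i hi => ?_
    have h1 := hAB i hi
    by_cases hgi : (EuclideanDomain.gcd A B).eval (y i) = 0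
    · refine (hcom ⟨i, hi, ?_, ?_⟩).elim
      · rw [hA', eval_mul, hgi, zero_mul]
      · rw [hB', eval_mul, hgi, zero_mul]
    · refine (mul_eq_zero.1 (?_ : (EuclideanDomain.gcd A B).eval (y i) *
        (A'.eval (y i) * z i + B'.eval (y i)) = 0)).resolve_left hgi
      have h2 := congrArg (eval (y i)) hA'
      have h3 := congrArg (eval (y i)) hB'
      rw [eval_mul] at h2 h3
      linear_combination h1 - z i * h2 - h3

/-- A rational curve `A(y) z + B(y) = 0` of degree two is not contained in a conic that avoids its
point at infinity, and meets such a conic in at most four points. -/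
theorem card_le_four_of_conic {y : ι → K} (hy : Function.Injective y) (z : ι → K)
    {s : Finset ι} {A B : K[X]} (hcop : IsCoprime A B) (hA : A.natDegree ≤ 1)
    (hB : B.natDegree ≤ 2) (hmax : A.natDegree = 1 ∨ B.natDegree = 2)
    (hAB : ∀ i ∈ s, A.eval (y i) * z i + B.eval (y i) = 0)
    {c : K} {U V : K[X]} (hc : c ≠ 0) (hU : U.natDegree ≤ 1) (hV : V.natDegree ≤ 2)
    (hUV : ∀ i ∈ s, c * z i ^ 2 + U.eval (y i) * z i + V.eval (y i) = 0) : s.card ≤ 4 := by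
  classical
  by_contra! hcard
  set D : K[X] := C c * B ^ 2 - A * U * B + A ^ 2 * V with hD
  have h1 : (C c * B ^ 2).natDegree ≤ 4 :=
    (natDegree_C_mul_le _ _).trans (natDegree_pow_le.trans (by omega))
  have h2 : (A * U * B).natDegree ≤ A.natDegree + 3 :=
    natDegree_mul_le.trans (by have := natDegree_mul_le (p := A) (q := U); omega)
  have h3 : (A ^ 2 * V).natDegree ≤ 2 * A.natDegree + 2 :=
    natDegree_mul_le.trans (by have := natDegree_pow_le (p := A) (n := 2); omega)
  have hdeg : D.natDegree ≤ 4 :=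
    (natDegree_add_le _ _).trans (max_le ((natDegree_sub_le _ _).trans
      (max_le h1 (h2.trans (by omega)))) (h3.trans (by omega)))
  have hD0 : D = 0 := by
    refine eq_zero_of_natDegree_lt_card_of_eval_eq_zero' D (s.image y) ?_ ?_
    · intro x hx
      obtain ⟨i, hi, rfl⟩ := Finset.mem_image.1 hx
      have e1 := hAB i hi
      have e2 := hUV i hi
      simp only [hD, eval_add, eval_sub, eval_mul, eval_pow, eval_C]
      linear_combination
        (c * (B.eval (y i) - A.eval (y i) * z i) - A.eval (y i) * U.eval (y i)) * e1 + A.eval (y i) ^ 2 * e2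
    · rw [Finset.card_image_of_injective _ hy]
      omega
  have hdvd : A ∣ C c * B ^ 2 := ⟨U * B - A * V, by linear_combination hD0⟩
  have hunit : IsUnit A := by
    have := (hcop.pow_right (n := 2)).dvd_of_dvd_mul_right hdvd
    exact isUnit_of_dvd_unit this (isUnit_C.2 hc.isUnit)
  have hA0 := natDegree_eq_zero_of_isUnit hunit
  have hB2 : B.natDegree = 2 := by omega
  have h4 : (C c * B ^ 2).natDegree = 4 := by
    rw [natDegree_C_mul hc, natDegree_pow, hB2]
  have h5 : C c * B ^ 2 = A * U * B - A ^ 2 * V := by linear_combination hD0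
  have h6 := natDegree_sub_le (A * U * B) (A ^ 2 * V)
  rw [← h5, h4] at h6
  have := le_max_iff.1 h6
  omega

/-- If all but `r` of the points lie on the line `a z + B(y) = 0`, then `h(t) ≤ t + 1 + r`. -/
theorem finrank_evalSpan_le_of_line [Fintype ι] (y z : ι → K) {a : K} (ha : a ≠ 0) {B : K[X]}
    (hB : B.natDegree ≤ 1) {s : Finset ι} (hs : ∀ i ∉ s, a * z i + B.eval (y i) = 0) (t : ℕ) :
    Module.finrank K (evalSpan y z t) ≤ t + 1 + s.card := by
  classical
  let φ : (degreeLT K (t + 1) × (s → K)) →ₗ[K] (ι → K) :=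
    { toFun := fun p i => if h : i ∈ s then p.2 ⟨i, h⟩ else (p.1 : K[X]).eval (y i)
      map_add' := fun p q => by ext i; by_cases h : i ∈ s <;> simp [h]
      map_smul' := fun c p => by ext i; by_cases h : i ∈ s <;> simp [h] }
  have hle : evalSpan y z t ≤ LinearMap.range φ := by
    refine Submodule.span_le.2 ?_
    rintro _ ⟨m, n, hmn, rfl⟩
    have hdeg : (X ^ m * (C (-a⁻¹) * B) ^ n : K[X]).natDegree < t + 1 := by
      have h1 : (X ^ m * (C (-a⁻¹) * B) ^ n : K[X]).natDegree ≤ m + n * 1 :=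
        natDegree_mul_le.trans (add_le_add (by simp) (natDegree_pow_le.trans
          (Nat.mul_le_mul_left _ ((natDegree_C_mul_le _ _).trans hB))))
      omega
    refine ⟨⟨⟨X ^ m * (C (-a⁻¹) * B) ^ n, mem_degreeLT.2 (degree_le_natDegree.trans_lt
      (by exact_mod_cast hdeg))⟩,
      fun i => y i ^ m * z i ^ n⟩, ?_⟩
    ext i
    by_cases h : i ∈ s
    · simp [φ, h]
    · have h1 : z i = -a⁻¹ * B.eval (y i) := by
        have := hs i h
        field_simp
        linear_combination this
      simp [φ, h, h1]
  calc Module.finrank K (evalSpan y z t) ≤ Module.finrank K (LinearMap.range φ) :=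
        Submodule.finrank_mono hle
    _ ≤ Module.finrank K (degreeLT K (t + 1) × (s → K)) := LinearMap.finrank_range_le φ
    _ = t + 1 + s.card := by
        rw [Module.finrank_prod, (degreeLTEquiv K (t + 1)).finrank_eq]
        simp

end Pencil

/-! ### Curves with a point of almost maximal multiplicity -/

section AffineMain

open Polynomial

variable {K ι : Type*} [Field K]

/-- The dehomogenized conic `c z² + U(y) z + V(y)` contains the points of `s`. Its coefficient `c`
is the value at the point at infinity of the `z`-axis. -/
def ConicThrough (y z : ι → K) (s : Finset ι) (c : K) (U V : K[X]) : Prop :=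
  U.natDegree ≤ 1 ∧ V.natDegree ≤ 2 ∧ ∀ i ∈ s, c * z i ^ 2 + U.eval (y i) * z i + V.eval (y i) = 0

/-- Whenever some conic contains a given subset of the points, one of the conics containing it does
not pass through the centre of projection, the point at infinity of the `z`-axis. -/
def AvoidsConics (y z : ι → K) : Prop :=
  ∀ s : Finset ι, (∃ c U V, ConicThrough y z s c U V ∧ (c ≠ 0 ∨ U ≠ 0 ∨ V ≠ 0)) →
    ∃ c U V, ConicThrough y z s c U V ∧ c ≠ 0

/-- If `h(t) = 2 t + 1` is less than the number of points, then no curve of degree `t` through the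
points has multiplicity `t - 1` at the centre of a sufficiently general projection. -/
theorem pencil_eq_zero [Fintype ι] {y : ι → K} (hy : Function.Injective y) {z : ι → K} {t : ℕ}
    (ht : 1 ≤ t) (hrank : Module.finrank K (evalSpan y z t) = 2 * t + 1)
    (hcard : Module.finrank K (evalSpan y z t) < Fintype.card ι) (hconic : AvoidsConics y z)
    {A B : K[X]} (hA : A.natDegree + 1 ≤ t) (hB : B.natDegree ≤ t)
    (hAB : ∀ i, A.eval (y i) * z i + B.eval (y i) = 0) : A = 0 ∧ B = 0 := by
  classical
  by_contra hne
  rw [not_and_or] at hne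
  obtain ⟨s, ⟨i₀, hi₀⟩, hs, hCB⟩ := exists_circuit hcard
  have hex : ∃ k : ℕ, ∃ A B : K[X], (A ≠ 0 ∨ B ≠ 0) ∧ A.natDegree ≤ k ∧ B.natDegree ≤ k + 1 ∧
      ∀ i ∈ s, A.eval (y i) * z i + B.eval (y i) = 0 :=
    ⟨t - 1, A, B, hne, by omega, by omega, fun i _ => hAB i⟩
  have hkt : Nat.find hex ≤ t - 1 :=
    Nat.find_min' hex ⟨A, B, hne, by omega, by omega, fun i _ => hAB i⟩
  obtain ⟨A₁, B₁, hne₁, hA₁, hB₁, hAB₁⟩ := Nat.find_spec hex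
  have hmin : ∀ l < Nat.find hex, ∀ A' B' : K[X], A'.natDegree ≤ l → B'.natDegree ≤ l + 1 →
      (∀ i ∈ s, A'.eval (y i) * z i + B'.eval (y i) = 0) → A' = 0 ∧ B' = 0 := by
    intro l hl A' B' hA' hB' hv
    by_contra hcon
    rw [not_and_or] at hcon
    exact Nat.find_min hex hl ⟨A', B', hcon, hA', hB', hv⟩
  generalize Nat.find hex = k at hkt hA₁ hB₁ hmin
  have hcop := isCoprime_of_minimal hy z (t := t) (by omega) ⟨i₀, hi₀⟩ hCB hne₁ hA₁ hB₁ hAB₁ hmin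
  have hA₁i : ∀ i ∈ s, A₁.eval (y i) ≠ 0 := by
    intro i hi h0
    obtain ⟨u, v, huv⟩ := hcop
    have h1 := congrArg (eval (y i)) huv
    have h2 := hAB₁ i hi
    rw [h0, zero_mul, zero_add] at h2
    simp [h0, h2] at h1
  -- the polynomial in the parameter that should separate `i₀` from the rest of the circuit
  set T : K[X] := ∏ j ∈ s.erase i₀, (X - C (y j)) with hT
  have hTdeg : T.natDegree = s.card - 1 := by
    rw [hT, natDegree_finsetProd_X_sub_C_eq_card, Finset.card_erase_of_mem hi₀]
  have hT0 : T.eval (y i₀) ≠ 0 := by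
    rw [hT, eval_prod, Finset.prod_ne_zero_iff]
    intro j hj
    have := Finset.ne_of_mem_erase hj
    simp only [eval_sub, eval_X, eval_C]
    exact sub_ne_zero.2 fun h => this (hy h.symm)
  have hTj : ∀ j ∈ s, j ≠ i₀ → T.eval (y j) = 0 := by
    intro j hj hji
    rw [hT, eval_prod]
    exact Finset.prod_eq_zero (Finset.mem_erase.2 ⟨hji, hj⟩) (by simp)
  rcases k with _ | l
  · -- the circuit lies on a line
    have hscard : t + 2 ≤ s.card := by
      by_contra! hlt
      exact hT0 (hCB i₀ hi₀ _ (eval_mem_evalSpan y z (by omega)) hTj)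
    obtain ⟨a, rfl⟩ : ∃ a, A₁ = C a := ⟨_, eq_C_of_natDegree_le_zero hA₁⟩
    have ha : a ≠ 0 := by simpa using hA₁i i₀ hi₀
    have hD : C a * B - B₁ * A = 0 := by
      refine eq_zero_of_natDegree_lt_card_of_eval_eq_zero' _ (s.image y) ?_ ?_
      · intro x hx
        obtain ⟨i, hi, rfl⟩ := Finset.mem_image.1 hx
        have e1 := hAB₁ i hi
        have e2 := hAB i
        simp only [eval_C, eval_sub, eval_mul] at e1 ⊢
        linear_combination a * e2 - A.eval (y i) * e1
      · rw [Finset.card_image_of_injective _ hy]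
        have e1 := natDegree_C_mul_le a B
        have e2 : (B₁ * A).natDegree ≤ (0 + 1) + A.natDegree :=
          natDegree_mul_le.trans (by omega)
        have := (natDegree_sub_le (C a * B) (B₁ * A)).trans
          (max_le (e1.trans hB) (e2.trans (by omega)))
        omega
    have hA0 : A ≠ 0 := by
      rintro rfl
      have hB0 : B = 0 := by simpa [ha] using hD
      simp [hB0] at hne
    -- the points off the line project to zeros of `A`
    have hoff : ∀ i ∉ Finset.univ.filter (fun i => A.eval (y i) = 0),
        a * z i + B₁.eval (y i) = 0 := by
      intro i hi
      have hi' : A.eval (y i) ≠ 0 := by simpa using hi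
      have e1 := congrArg (eval (y i)) hD
      have e2 := hAB i
      simp only [eval_C, eval_sub, eval_mul, eval_zero] at e1
      refine (mul_eq_zero.1 (?_ : A.eval (y i) * (a * z i + B₁.eval (y i)) = 0)).resolve_left hi'
      linear_combination a * e2 - e1
    have hroots : (Finset.univ.filter (fun i => A.eval (y i) = 0)).card ≤ A.natDegree := by
      rw [← Finset.card_image_of_injective _ hy]
      refine card_le_degree_of_subset_roots fun x hx => ?_
      obtain ⟨i, hi, rfl⟩ := Finset.mem_image.1 hx
      exact (mem_roots hA0).2 (Finset.mem_filter.1 hi).2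
    have := finrank_evalSpan_le_of_line y z ha (by omega) hoff t
    omega
  · have hmax : A₁.natDegree = l + 1 ∨ B₁.natDegree = l + 2 := by
      by_contra! hlt
      have h := hmin l l.lt_succ_self A₁ B₁ (by omega) (by omega) hAB₁
      simp [h.1, h.2] at hne₁
    -- the circuit lies on a rational curve on which degree `t` separates too many points
    have hTbig : ¬ T.natDegree ≤ (l + 1) * (t - l) + (t - l) + l := by
      intro hle
      obtain ⟨e, he, hTe⟩ := exists_evalSpan_of_isCoprime y z hcop hA₁ hB₁ hmax (t - l) T hle
      rw [show t - l + l = t by omega] at he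
      have hes := hCB i₀ hi₀ e he fun j hj hji => by
        have h1 := hTe j (hAB₁ j hj)
        rw [hTj j hj hji] at h1
        exact (mul_eq_zero.1 h1.symm).resolve_left (pow_ne_zero _ (hA₁i j hj))
      have h1 := hTe i₀ (hAB₁ i₀ hi₀)
      rw [hes, mul_zero] at h1
      exact hT0 h1
    rcases l with _ | l
    · -- an irreducible conic through the centre
      obtain ⟨c, U, V, ⟨hU, hV, hUV⟩, hc⟩ := hconic s ⟨0, A₁, B₁, ⟨hA₁, hB₁, fun i hi => by
        simpa using hAB₁ i hi⟩, Or.inr hne₁⟩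
      have := card_le_four_of_conic hy z hcop hA₁ hB₁ hmax hAB₁ hc hU hV hUV
      omega
    · obtain ⟨m, rfl⟩ : ∃ m, t = m + 2 + (l + 1) := ⟨t - 2 - (l + 1), by omega⟩
      refine hTbig ?_
      rw [show m + 2 + (l + 1) - (l + 1) = m + 2 by omega, hTdeg]
      have : (l + 1 + 1) * (m + 2) = l * m + 2 * l + 2 * m + 4 := by ring
      have := Nat.zero_le (l * m)
      omega

theorem natDegree_le_of_mem_degreeLT {d : ℕ} {p : K[X]} (hp : p ∈ degreeLT K (d + 1)) :
    p.natDegree ≤ d := by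
  rcases eq_or_ne p 0 with rfl | h
  · simp
  · exact Nat.lt_succ_iff.1 ((natDegree_lt_iff_degree_lt h).2 (mem_degreeLT.1 hp))

/-- A nonzero relation between the values at the points of the monomials of degree at most two is a
conic through the points. -/
theorem exists_conicThrough [Fintype ι] (y z : ι → K)
    (h : Module.finrank K (evalSpan y z 2) < 6) :
    ∃ c U V, ConicThrough y z Finset.univ c U V ∧ (c ≠ 0 ∨ U ≠ 0 ∨ V ≠ 0) := by
  let φ : (K × degreeLT K 2 × degreeLT K 3) →ₗ[K] (ι → K) :=
    { toFun := fun p i => p.1 * z i ^ 2 + (p.2.1 : K[X]).eval (y i) * z i +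
        (p.2.2 : K[X]).eval (y i)
      map_add' := fun p q => by ext i; simp; ring
      map_smul' := fun c p => by ext i; simp; ring }
  have hle : LinearMap.range φ ≤ evalSpan y z 2 := by
    rintro _ ⟨⟨c, U, V⟩, rfl⟩
    have h1 := range_pencilEval_le y z 2 ⟨⟨U, V⟩, rfl⟩
    have h2 := Submodule.smul_mem _ c (mem_evalSpan_monomial y z (a := 0) (b := 2) (d := 2) le_rfl)
    convert Submodule.add_mem _ h2 h1 using 1
    ext i
    simp [φ, pencilEval]
    ring
  have hker : LinearMap.ker φ ≠ ⊥ := by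
    intro hbot
    have h1 := LinearMap.finrank_range_add_finrank_ker φ
    rw [hbot, finrank_bot, Module.finrank_prod, finrank_degreeLT_prod, Module.finrank_self] at h1
    have h2 := Submodule.finrank_mono hle
    omega
  obtain ⟨⟨c, U, V⟩, hp, hp0⟩ := Submodule.exists_mem_ne_zero_of_ne_bot hker
  refine ⟨c, U, V, ⟨?_, ?_, fun i _ => congrFun hp i⟩, ?_⟩
  · exact natDegree_le_of_mem_degreeLT U.2
  · exact natDegree_le_of_mem_degreeLT V.2
  · by_contra! hcon
    refine hp0 ?_
    ext1
    · exact hcon.1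
    · exact Prod.ext (Subtype.ext hcon.2.1) (Subtype.ext hcon.2.2)

theorem y_mul_mem_range_pencilEval (y z : ι → K) {d : ℕ} {e : ι → K}
    (he : e ∈ LinearMap.range (pencilEval y z d)) :
    (fun i => y i * e i) ∈ LinearMap.range (pencilEval y z (d + 1)) := by
  obtain ⟨⟨⟨A, hA⟩, ⟨B, hB⟩⟩, rfl⟩ := he
  have hX : ∀ {n : ℕ} {Q : K[X]}, Q ∈ degreeLT K n → X * Q ∈ degreeLT K (n + 1) := by
    intro n Q hQ
    rcases eq_or_ne Q 0 with rfl | h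
    · simp
    · rw [mem_degreeLT, mul_comm, degree_mul_X]
      have := mem_degreeLT.1 hQ
      rw [degree_eq_natDegree h] at this ⊢
      norm_cast at this ⊢
      omega
  refine ⟨⟨⟨X * A, hX hA⟩, ⟨X * B, hX hB⟩⟩, ?_⟩
  ext i
  simp [pencilEval]
  ring

theorem range_pencilEval_mono (y z : ι → K) (d : ℕ) :
    LinearMap.range (pencilEval y z d) ≤ LinearMap.range (pencilEval y z (d + 1)) := by
  rintro _ ⟨⟨⟨A, hA⟩, ⟨B, hB⟩⟩, rfl⟩
  exact ⟨⟨⟨A, degreeLT_mono d.le_succ hA⟩, ⟨B, degreeLT_mono (d + 1).le_succ hB⟩⟩, rfl⟩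

/-- Once every function of degree `d ≥ 2` is of the form `A(y) z + B(y)`, the same holds in degree
`d + 1`. -/
theorem evalSpan_succ_le_range_pencilEval (y z : ι → K) {d : ℕ} (hd : 2 ≤ d)
    (h : evalSpan y z d ≤ LinearMap.range (pencilEval y z d)) :
    evalSpan y z (d + 1) ≤ LinearMap.range (pencilEval y z (d + 1)) := by
  refine evalSpan_succ_le y z (h.trans (range_pencilEval_mono y z d))
    (fun e he => y_mul_mem_range_pencilEval y z (h he)) fun e he => ?_
  obtain ⟨⟨⟨A, hA⟩, ⟨B, hB⟩⟩, rfl⟩ := h he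
  obtain ⟨d, rfl⟩ : ∃ c, d = c + 1 := ⟨d - 1, by omega⟩
  have hAd := natDegree_le_of_mem_degreeLT hA
  -- write `A = A(0) + y A'` and use that `z²` and `A'(y) z²` have degree at most `d`
  have h1 : (fun i => A.coeff 0 * z i ^ 2) ∈ evalSpan y z (d + 1) := by
    simpa using eval_mul_pow_mem_evalSpan y z (C := C (A.coeff 0)) (b := 2) (d := d + 1)
      (by rw [natDegree_C]; omega)
  have h2 : (fun i => A.divX.eval (y i) * z i ^ 2) ∈ evalSpan y z (d + 1) :=
    eval_mul_pow_mem_evalSpan y z (by rw [natDegree_divX_eq_natDegree_tsub_one]; omega)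
  have h3 := Submodule.add_mem _ (range_pencilEval_mono y z _ (h h1))
    (y_mul_mem_range_pencilEval y z (h h2))
  have h4 : (fun i => B.eval (y i) * z i) ∈ LinearMap.range (pencilEval y z (d + 1 + 1)) :=
    ⟨⟨⟨B, hB⟩, 0⟩, by ext i; simp [pencilEval]⟩
  convert Submodule.add_mem _ h3 h4 using 1
  ext i
  have h5 := congrArg (eval (y i)) (divX_mul_X_add A)
  simp only [eval_add, eval_mul, eval_X, eval_C] at h5
  simp only [pencilEval, LinearMap.coe_mk, AddHom.coe_mk, Pi.add_apply]
  linear_combination (-z i ^ 2) * h5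

theorem evalSpan_one_le (y z : ι → K) :
    evalSpan y z 1 ≤ LinearMap.range (pencilEval y z 1) := by
  refine Submodule.span_le.2 ?_
  rintro _ ⟨a, b, hab, rfl⟩
  rcases b with _ | b
  · have := pencil_mem_range y z (d := 1) (A := 0) (B := X ^ a) (by simp)
      (lt_of_le_of_lt (degree_X_pow_le a) (by norm_cast; omega))
    simpa using this
  · obtain ⟨rfl, rfl⟩ : a = 0 ∧ b = 0 := by omega
    have := pencil_mem_range y z (d := 1) (A := 1) (B := 0) (by simp)
      (by rw [degree_zero]; exact WithBot.bot_lt_coe _)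
    simpa using this

/-- If some conic through the points avoids the centre of projection, then on the points `z²` is a
combination of the other monomials of degree at most two. -/
theorem evalSpan_two_le_of_conicThrough [Fintype ι] {y z : ι → K} {c : K} {U V : K[X]}
    (h : ConicThrough y z Finset.univ c U V) (hc : c ≠ 0) :
    evalSpan y z 2 ≤ LinearMap.range (pencilEval y z 2) := by
  obtain ⟨hU, hV, hUV⟩ := h
  refine evalSpan_succ_le y z ((evalSpan_one_le y z).trans (range_pencilEval_mono y z 1))
    (fun e he => y_mul_mem_range_pencilEval y z (evalSpan_one_le y z he)) fun e he => ?_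
  obtain ⟨⟨⟨A, hA⟩, ⟨B, hB⟩⟩, rfl⟩ := evalSpan_one_le y z he
  obtain ⟨a, rfl⟩ : ∃ a, A = C a :=
    ⟨_, eq_C_of_natDegree_le_zero (natDegree_le_of_mem_degreeLT hA)⟩
  have hBd := natDegree_le_of_mem_degreeLT hB
  have h1 : (B - C (a / c) * U).natDegree ≤ 1 :=
    (natDegree_sub_le _ _).trans (max_le hBd ((natDegree_C_mul_le _ _).trans hU))
  have h2 : (-C (a / c) * V).natDegree ≤ 2 := by
    rw [← C_neg]
    exact (natDegree_C_mul_le _ _).trans hV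
  have := pencil_mem_range y z (d := 2) (A := B - C (a / c) * U) (B := -C (a / c) * V)
    (degree_le_natDegree.trans_lt (by norm_cast; omega))
    (degree_le_natDegree.trans_lt (by norm_cast; omega))
  convert this using 1
  ext i
  have h3 := hUV i (Finset.mem_univ i)
  simp only [pencilEval, LinearMap.coe_mk, AddHom.coe_mk, eval_C, eval_sub, eval_mul, eval_neg]
  field_simp
  linear_combination a * h3

theorem finrank_evalSpan_eq [Fintype ι] {y : ι → K} (hy : Function.Injective y) {z : ι → K} {t : ℕ}
    (hlow : ∀ j < t, 2 * j + 3 ≤ Module.finrank K (evalSpan y z (j + 1)))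
    (hup : Module.finrank K (evalSpan y z (t + 1)) ≤ 2 * t + 2)
    (hcard : Module.finrank K (evalSpan y z t) < Fintype.card ι) :
    Module.finrank K (evalSpan y z t) = 2 * t + 1 ∧
      Module.finrank K (evalSpan y z (t + 1)) = 2 * t + 2 := by
  have h1 := finrank_evalSpan_lt_succ hy z hcard
  have h2 : 2 * t + 1 ≤ Module.finrank K (evalSpan y z t) := by
    rcases t with _ | t
    · have : Nonempty ι := Fintype.card_pos_iff.1 (by omega)
      exact finrank_evalSpan_zero y z
    · exact hlow t t.lt_succ_self
  omega

theorem ker_pencilEval_eq_bot [Fintype ι] {y : ι → K} (hy : Function.Injective y) {z : ι → K}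
    {t : ℕ} (hrank : Module.finrank K (evalSpan y z t) = 2 * t + 1)
    (hcard : Module.finrank K (evalSpan y z t) < Fintype.card ι) (hconic : AvoidsConics y z)
    {j : ℕ} (hj : j < t) : LinearMap.ker (pencilEval y z (j + 1)) = ⊥ := by
  refine (Submodule.eq_bot_iff _).2 ?_
  rintro ⟨⟨A, hA⟩, ⟨B, hB⟩⟩ hp
  have h1 := natDegree_le_of_mem_degreeLT hA
  have h2 := natDegree_le_of_mem_degreeLT hB
  obtain ⟨rfl, rfl⟩ := pencil_eq_zero hy (t := t) (by omega) hrank hcard hconic (A := A) (B := B)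
    (by omega) (by omega) fun i => congrFun hp i
  rfl

/-- From degree `t + 1` on, the forms with multiplicity at least `d - 1` at the centre of
projection induce all the functions of degree `d` on the points. -/
theorem range_pencilEval_eq [Fintype ι] {y : ι → K} (hy : Function.Injective y) {z : ι → K}
    {t : ℕ} (hrank : Module.finrank K (evalSpan y z t) = 2 * t + 1)
    (hup : Module.finrank K (evalSpan y z (t + 1)) = 2 * t + 2)
    (hcard : Module.finrank K (evalSpan y z t) < Fintype.card ι) (hconic : AvoidsConics y z)
    {d : ℕ} (hd : t < d) : LinearMap.range (pencilEval y z d) = evalSpan y z d := by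
  refine le_antisymm (range_pencilEval_le y z d) ?_
  have hbase : evalSpan y z (max t 2) ≤ LinearMap.range (pencilEval y z (max t 2)) := by
    rcases le_or_gt 2 t with ht | ht
    · rw [max_eq_left ht]
      refine (Submodule.eq_of_le_of_finrank_eq (range_pencilEval_le y z t) ?_).ge
      obtain ⟨j, rfl⟩ : ∃ j, t = j + 1 := ⟨t - 1, by omega⟩
      rw [LinearMap.finrank_range_of_inj (LinearMap.ker_eq_bot.1
        (ker_pencilEval_eq_bot hy hrank hcard hconic j.lt_succ_self)), hrank,
        finrank_degreeLT_prod]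
    · rw [max_eq_right ht.le]
      obtain ⟨c, U, V, h, hc⟩ : ∃ c U V, ConicThrough y z Finset.univ c U V ∧ c ≠ 0 := by
        refine hconic Finset.univ ?_
        obtain rfl | rfl : t = 0 ∨ t = 1 := by omega
        · -- the points are collinear, and the line counts as a degenerate conic with `c = 0`
          have hker : LinearMap.ker (pencilEval y z 1) ≠ ⊥ := by
            intro hbot
            have h1 := LinearMap.finrank_range_add_finrank_ker (pencilEval y z 1)
            rw [hbot, finrank_bot, finrank_degreeLT_prod] at h1
            have h2 := Submodule.finrank_mono (range_pencilEval_le y z 1)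
            have h3 : Module.finrank K (evalSpan y z 1) = 2 := hup
            omega
          obtain ⟨⟨A, B⟩, hp, hp0⟩ := Submodule.exists_mem_ne_zero_of_ne_bot hker
          refine ⟨0, A, B, ⟨(natDegree_le_of_mem_degreeLT A.2).trans (by omega),
            (natDegree_le_of_mem_degreeLT B.2).trans (by omega), fun i _ => ?_⟩, ?_⟩
          · simpa [pencilEval] using congrFun hp i
          · by_contra! hcon
            exact hp0 (Prod.ext (Subtype.ext hcon.2.1) (Subtype.ext hcon.2.2))
        · have h3 : Module.finrank K (evalSpan y z 2) = 4 := hup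
          exact exists_conicThrough y z (by omega)
      exact evalSpan_two_le_of_conicThrough h hc
  rcases le_or_gt (max t 2) d with hle | hlt
  · induction d, hle using Nat.le_induction with
    | base => exact hbase
    | succ n hn ih =>
      have hn2 : 2 ≤ n := le_trans (le_max_right t 2) hn
      rcases eq_or_ne n t with rfl | hne
      · exact evalSpan_succ_le_range_pencilEval y z hn2 (by rwa [max_eq_left hn2] at hbase)
      · have : t ≤ n := le_trans (le_max_left t 2) hn
        exact evalSpan_succ_le_range_pencilEval y z hn2 (ih (by omega))
  · obtain rfl : d = 1 := by
      rcases lt_max_iff.1 hlt with h | h <;> omega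
    exact evalSpan_one_le y z

end AffineMain

/-! ### Forms with a point of almost maximal multiplicity at `(0 : 0 : 1)` -/

section Forms

open MvPolynomial

variable {K : Type*} [Field K]

instance (d : ℕ) : FiniteDimensional K (homogeneousSubmodule (Fin 3) K d) :=
  Module.Finite.iff_fg.2 (homogeneousSubmodule_fg _ _ _)

theorem finrank_homogeneousSubmodule (d : ℕ) :
    Module.finrank K (homogeneousSubmodule (Fin 3) K d) = (d + 2).choose 2 := by
  have e : {m : Fin 3 →₀ ℕ | m.degree = d} ≃ Sym (Fin 3) d :=
    (Equiv.subtypeEquivRight fun m => by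
      simp [Finsupp.degree_eq_sum, Finsupp.sum_fintype]).trans (Sym.equivNatSum (Fin 3) d).symm
  have : Fintype {m : Fin 3 →₀ ℕ | m.degree = d} := Fintype.ofEquiv _ e.symm
  rw [homogeneousSubmodule_eq_finsupp_supported,
    (AddMonoidAlgebra.supportedEquivFinsupp _).finrank_eq, Module.finrank_finsupp_self,
    Fintype.card_congr e, Sym.card_sym_eq_choose, Fintype.card_fin,
    show 3 + d - 1 = d + 2 by omega, ← Nat.choose_symm (by omega)]
  congr 1
  omega

/-- A space of polynomials containing all monomials of degree `d` contains all forms of degree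
`d`. -/
theorem homogeneous_mem_of_monomials {d : ℕ} {W : Submodule K (MvPolynomial (Fin 3) K)}
    {f : MvPolynomial (Fin 3) K} (hf : f.IsHomogeneous d)
    (h : ∀ m ∈ f.support, m.degree = d → X 0 ^ m 0 * X 1 ^ m 1 * X 2 ^ m 2 ∈ W) : f ∈ W := by
  rw [f.as_sum]
  refine Submodule.sum_mem _ fun m hm => ?_
  have h1 : m.degree = d := by
    by_contra hne
    exact (mem_support_iff.1 hm) (hf.coeff_eq_zero hne)
  have h2 : monomial m (coeff m f) =
      coeff m f • (X 0 ^ m 0 * X 1 ^ m 1 * X 2 ^ m 2 : MvPolynomial (Fin 3) K) := by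
    rw [monomial_eq, smul_eq_C_mul, Finsupp.prod_fintype _ _ (by simp), Fin.prod_univ_three]
  rw [h2]
  exact Submodule.smul_mem _ _ (h m hm h1)

/-- The binary form `x₀ ^ d * p(x₁ / x₀)`, as a form in three variables. -/
def binaryForm (d : ℕ) : Polynomial K →ₗ[K] MvPolynomial (Fin 3) K where
  toFun p := ∑ s ∈ Finset.range (d + 1), p.coeff s • (X 0 ^ (d - s) * X 1 ^ s)
  map_add' p q := by simp [add_smul, Finset.sum_add_distrib]
  map_smul' c p := by simp [Finset.smul_sum, mul_smul]

theorem binaryForm_isHomogeneous (d : ℕ) (p : Polynomial K) :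
    (binaryForm d p).IsHomogeneous d := by
  refine IsHomogeneous.sum _ _ _ fun s hs => ?_
  have h : d - s + s = d := by have := Finset.mem_range.1 hs; omega
  rw [smul_eq_C_mul]
  refine IsHomogeneous.C_mul ?_ _
  have := (isHomogeneous_X_pow (R := K) (0 : Fin 3) (d - s)).mul
    (isHomogeneous_X_pow (R := K) (1 : Fin 3) s)
  rwa [h] at this

theorem binaryForm_X_pow {d s : ℕ} (h : s ≤ d) :
    binaryForm d (Polynomial.X ^ s : Polynomial K) = X 0 ^ (d - s) * X 1 ^ s := by
  have : s ∈ Finset.range (d + 1) := Finset.mem_range.2 (by omega)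
  simp [binaryForm, Polynomial.coeff_X_pow, this]

theorem eval_binaryForm {d : ℕ} {p : Polynomial K} (hp : p.natDegree ≤ d) (y z : K) :
    eval ![1, y, z] (binaryForm d p) = p.eval y := by
  rw [Polynomial.eval_eq_sum_range' (Nat.lt_succ_of_le hp)]
  simp [binaryForm]

theorem eval_binaryForm_center {d : ℕ} (hd : 1 ≤ d) (p : Polynomial K) (c : K) :
    eval ![0, 0, c] (binaryForm d p) = 0 := by
  simp only [binaryForm, LinearMap.coe_mk, AddHom.coe_mk, map_sum, smul_eval, map_mul, map_pow,
    eval_X, Matrix.cons_val_zero, Matrix.cons_val_one]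
  refine Finset.sum_eq_zero fun s _ => ?_
  rw [← pow_add, zero_pow (by omega), mul_zero]

/-- The ideal of the point `(0 : 0 : 1)`. -/
def centerIdeal (K : Type*) [Field K] : Ideal (MvPolynomial (Fin 3) K) :=
  Ideal.span {X 0, X 1}

theorem binaryForm_mem_centerIdeal_pow {j d : ℕ} (h : j ≤ d) (p : Polynomial K) :
    binaryForm d p ∈ centerIdeal K ^ j := by
  refine Ideal.pow_le_pow_right h ?_
  simp only [binaryForm, LinearMap.coe_mk, AddHom.coe_mk]
  refine Ideal.sum_mem _ fun s hs => ?_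
  have hs' : d - s + s = d := by have := Finset.mem_range.1 hs; omega
  rw [smul_eq_C_mul]
  refine Ideal.mul_mem_left _ _ ?_
  rw [← hs', pow_add, hs']
  exact Ideal.mul_mem_mul (Ideal.pow_mem_pow (Ideal.subset_span (by simp)) _)
    (Ideal.pow_mem_pow (Ideal.subset_span (by simp)) _)

theorem le_of_mem_centerIdeal_pow {j : ℕ} {f : MvPolynomial (Fin 3) K}
    (hf : f ∈ centerIdeal K ^ j) : ∀ m ∈ f.support, j ≤ m 0 + m 1 := by
  have h : ∀ j, centerIdeal K ^ j ≤
      Ideal.span ((fun m => monomial m (1 : K)) '' {m : Fin 3 →₀ ℕ | j ≤ m 0 + m 1}) := by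
    intro j
    induction j with
    | zero =>
      refine le_top.trans (le_of_eq (Eq.symm ?_))
      exact (Ideal.eq_top_iff_one _).2 (Ideal.subset_span ⟨0, by simp, rfl⟩)
    | succ j ih =>
      rw [pow_succ]
      refine (Ideal.mul_mono ih le_rfl).trans ?_
      rw [centerIdeal, Ideal.span_mul_span']
      refine Ideal.span_le.2 ?_
      rintro _ ⟨_, ⟨m, hm, rfl⟩, x, hx, rfl⟩
      rcases hx with rfl | rfl
      · refine Ideal.subset_span ⟨m + Finsupp.single 0 1, ?_, by simp [X, monomial_mul]⟩
        simp at hm ⊢; omega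
      · refine Ideal.subset_span ⟨m + Finsupp.single 1 1, ?_, by simp [X, monomial_mul]⟩
        simp at hm ⊢; omega
  intro m hm
  obtain ⟨m', hm', hle⟩ := mem_ideal_span_monomial_image.1 (h j hf) m hm
  exact le_trans hm' (add_le_add (hle 0) (hle 1))

/-- The form `A z + B` of degree `d + 1` with multiplicity `d` at `(0 : 0 : 1)`, from its
dehomogenized coefficients. -/
def pencilForm (d : ℕ) : (Polynomial.degreeLT K (d + 1) × Polynomial.degreeLT K (d + 2)) →ₗ[K]
    MvPolynomial (Fin 3) K :=
  LinearMap.coprod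
    ((LinearMap.mulLeft K (X 2)) ∘ₗ binaryForm d ∘ₗ (Polynomial.degreeLT K (d + 1)).subtype)
    (binaryForm (d + 1) ∘ₗ (Polynomial.degreeLT K (d + 2)).subtype)

theorem pencilForm_apply (d : ℕ)
    (p : Polynomial.degreeLT K (d + 1) × Polynomial.degreeLT K (d + 2)) :
    pencilForm d p = X 2 * binaryForm d p.1 + binaryForm (d + 1) p.2 := rfl

theorem eval_pencilForm (d : ℕ)
    (p : Polynomial.degreeLT K (d + 1) × Polynomial.degreeLT K (d + 2)) (y z : K) :
    eval ![1, y, z] (pencilForm d p) =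
      (p.1 : Polynomial K).eval y * z + (p.2 : Polynomial K).eval y := by
  rw [pencilForm_apply, map_add, map_mul, eval_binaryForm (natDegree_le_of_mem_degreeLT p.1.2),
    eval_binaryForm (natDegree_le_of_mem_degreeLT p.2.2)]
  simp [mul_comm]

theorem X_pow_mem_degreeLT {s d : ℕ} (h : s < d) :
    (Polynomial.X ^ s : Polynomial K) ∈ Polynomial.degreeLT K d :=
  Polynomial.mem_degreeLT.2 ((Polynomial.degree_X_pow_le s).trans_lt (by exact_mod_cast h))

theorem monomial_mem_range_pencilForm {d : ℕ} {m : Fin 3 →₀ ℕ} (hmd : m.degree = d + 1)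
    (hm : m 2 ≤ 1) :
    X 0 ^ m 0 * X 1 ^ m 1 * X 2 ^ m 2 ∈ LinearMap.range (pencilForm (K := K) d) := by
  rw [Finsupp.degree_eq_sum, Fin.sum_univ_three] at hmd
  obtain h2 | h2 : m 2 = 0 ∨ m 2 = 1 := by omega
  · refine ⟨⟨0, ⟨Polynomial.X ^ m 1, X_pow_mem_degreeLT (by omega)⟩⟩, ?_⟩
    rw [pencilForm_apply]
    simp only [ZeroMemClass.coe_zero, map_zero, mul_zero, zero_add, h2, pow_zero, mul_one]
    rw [binaryForm_X_pow (by omega), show d + 1 - m 1 = m 0 by omega]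
  · refine ⟨⟨⟨Polynomial.X ^ m 1, X_pow_mem_degreeLT (by omega)⟩, 0⟩, ?_⟩
    rw [pencilForm_apply]
    simp only [ZeroMemClass.coe_zero, map_zero, add_zero, h2, pow_one]
    rw [binaryForm_X_pow (by omega), show d - m 1 = m 0 by omega]
    ring

theorem range_pencilForm (d : ℕ) :
    LinearMap.range (pencilForm (K := K) d) =
      homogeneousSubmodule (Fin 3) K (d + 1) ⊓ (centerIdeal K ^ d).restrictScalars K := by
  refine le_antisymm ?_ ?_
  · rintro _ ⟨p, rfl⟩
    rw [pencilForm_apply]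
    refine ⟨IsHomogeneous.add ?_ (binaryForm_isHomogeneous _ _), ?_⟩
    · have := (isHomogeneous_X K (2 : Fin 3)).mul (binaryForm_isHomogeneous d (p.1 : Polynomial K))
      rwa [add_comm 1 d] at this
    · exact Ideal.add_mem _ (Ideal.mul_mem_left _ _ (binaryForm_mem_centerIdeal_pow le_rfl _))
        (binaryForm_mem_centerIdeal_pow d.le_succ _)
  · rintro f ⟨hf, hfc⟩
    refine homogeneous_mem_of_monomials hf fun m hm hmd => ?_
    have h1 := le_of_mem_centerIdeal_pow hfc m hm
    refine monomial_mem_range_pencilForm hmd ?_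
    rw [Finsupp.degree_eq_sum, Fin.sum_univ_three] at hmd
    omega

theorem eq_zero_of_forall_conic_eq_zero [Infinite K] {c : K} {U V : Polynomial K}
    (h : ∀ y z, c * z ^ 2 + U.eval y * z + V.eval y = 0) : c = 0 ∧ U = 0 ∧ V = 0 := by
  have h1 : ∀ y, c = 0 ∧ U.eval y = 0 ∧ V.eval y = 0 := by
    intro y
    have : (Polynomial.C c * Polynomial.X ^ 2 + Polynomial.C (U.eval y) * Polynomial.X +
        Polynomial.C (V.eval y) : Polynomial K) = 0 :=
      Polynomial.funext fun z => by simpa using h y z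
    refine ⟨?_, ?_, ?_⟩
    · simpa [Polynomial.coeff_X, Polynomial.coeff_C] using
        congrArg (fun p => Polynomial.coeff p 2) this
    · simpa [Polynomial.coeff_X, Polynomial.coeff_C] using
        congrArg (fun p => Polynomial.coeff p 1) this
    · simpa [Polynomial.coeff_X, Polynomial.coeff_C] using
        congrArg (fun p => Polynomial.coeff p 0) this
  exact ⟨(h1 0).1, Polynomial.funext fun y => by simpa using (h1 y).2.1,
    Polynomial.funext fun y => by simpa using (h1 y).2.2⟩

theorem pencilForm_injective [Infinite K] (d : ℕ) :
    Function.Injective (pencilForm (K := K) d) := by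
  refine LinearMap.ker_eq_bot.1 ((Submodule.eq_bot_iff _).2 fun p hp => ?_)
  have hp0 : pencilForm d p = 0 := hp
  have := eq_zero_of_forall_conic_eq_zero (c := (0 : K)) (U := p.1) (V := p.2) fun y z => by
    have := eval_pencilForm d p y z
    rw [hp0, map_zero] at this
    rw [zero_mul, zero_add, ← this]
  exact Prod.ext (Subtype.ext this.2.1) (Subtype.ext this.2.2)

/-- The quadratic form `c z² + U z + V`, from its dehomogenized coefficients. -/
def conicForm : (K × Polynomial.degreeLT K 2 × Polynomial.degreeLT K 3) →ₗ[K]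
    MvPolynomial (Fin 3) K :=
  LinearMap.coprod (LinearMap.toSpanSingleton K _ (X 2 ^ 2)) (pencilForm 1)

theorem conicForm_apply (p : K × Polynomial.degreeLT K 2 × Polynomial.degreeLT K 3) :
    conicForm p = p.1 • X 2 ^ 2 + pencilForm 1 p.2 := rfl

theorem eval_conicForm (p : K × Polynomial.degreeLT K 2 × Polynomial.degreeLT K 3) (y z : K) :
    eval ![1, y, z] (conicForm p) =
      p.1 * z ^ 2 + (p.2.1 : Polynomial K).eval y * z + (p.2.2 : Polynomial K).eval y := by
  rw [conicForm_apply, map_add, eval_pencilForm, smul_eval]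
  simp [add_assoc]

theorem eval_conicForm_center (p : K × Polynomial.degreeLT K 2 × Polynomial.degreeLT K 3) :
    eval ![0, 0, 1] (conicForm p) = p.1 := by
  rw [conicForm_apply, pencilForm_apply, map_add, map_add, map_mul,
    eval_binaryForm_center le_rfl, eval_binaryForm_center (by omega), smul_eval]
  simp

theorem range_conicForm :
    LinearMap.range (conicForm (K := K)) = homogeneousSubmodule (Fin 3) K 2 := by
  refine le_antisymm ?_ fun f hf => homogeneous_mem_of_monomials hf fun m _ hmd => ?_
  · rintro _ ⟨p, rfl⟩
    rw [conicForm_apply, smul_eq_C_mul]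
    exact ((isHomogeneous_X_pow _ _).C_mul _).add
      ((range_pencilForm (K := K) 1).le ⟨p.2, rfl⟩).1
  · have hsum := hmd
    rw [Finsupp.degree_eq_sum, Fin.sum_univ_three] at hsum
    by_cases h2 : m 2 = 2
    · obtain ⟨h0, h1⟩ : m 0 = 0 ∧ m 1 = 0 := by omega
      exact ⟨⟨1, 0⟩, by simp [conicForm_apply, h0, h1, h2]⟩
    · obtain ⟨p, hp⟩ := monomial_mem_range_pencilForm (K := K) (d := 1) hmd (by omega)
      exact ⟨⟨0, p⟩, by simp [conicForm_apply, hp]⟩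

end Forms

/-! ### Linear changes of coordinates -/

section Coordinates

open MvPolynomial

variable {K : Type*} [Field K]

/-- The substitution `f ↦ f ∘ g` for a linear map `g`. -/
def linSubst (g : (Fin 3 → K) →ₗ[K] (Fin 3 → K)) :
    MvPolynomial (Fin 3) K →ₐ[K] MvPolynomial (Fin 3) K :=
  aeval fun i => ∑ j, C (g (Pi.single j 1) i) * X j

theorem eval_linSubst (g : (Fin 3 → K) →ₗ[K] (Fin 3 → K)) (v : Fin 3 → K)
    (f : MvPolynomial (Fin 3) K) : eval v (linSubst g f) = eval (g v) f := by
  induction f using MvPolynomial.induction_on with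
  | C a => simp [linSubst]
  | add p q hp hq => simp [hp, hq]
  | mul_X p i hp =>
    rw [map_mul, map_mul, hp, map_mul, eval_X]
    congr 1
    conv_rhs => rw [LinearMap.pi_apply_eq_sum_univ g v]
    simp only [linSubst, aeval_X, map_sum, map_mul, eval_C, eval_X, Finset.sum_apply,
      Pi.smul_apply, smul_eq_mul]
    refine Finset.sum_congr rfl fun j _ => ?_
    have h : (Pi.single j 1 : Fin 3 → K) = fun k => if j = k then 1 else 0 := by
      ext k
      simp [Pi.single_apply, eq_comm]
    rw [mul_comm, h]

theorem linSubst_isHomogeneous (g : (Fin 3 → K) →ₗ[K] (Fin 3 → K)) {d : ℕ}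
    {f : MvPolynomial (Fin 3) K} (hf : f.IsHomogeneous d) : (linSubst g f).IsHomogeneous d := by
  have := hf.aeval (fun i => ∑ j, C (g (Pi.single j 1) i) * X j : Fin 3 → MvPolynomial (Fin 3) K)
    (n := 1) fun i => IsHomogeneous.sum _ _ _ fun j _ => (isHomogeneous_X K j).C_mul _
  simpa [linSubst] using this

theorem linSubst_linSubst_symm [Infinite K] (g : (Fin 3 → K) ≃ₗ[K] (Fin 3 → K))
    (f : MvPolynomial (Fin 3) K) : linSubst g.toLinearMap (linSubst g.symm.toLinearMap f) = f :=
  MvPolynomial.funext fun v => by simp [eval_linSubst]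

theorem eval_smul_of_isHomogeneous {d : ℕ} {f : MvPolynomial (Fin 3) K} (hf : f.IsHomogeneous d)
    (c : K) (v : Fin 3 → K) : eval (c • v) f = c ^ d * eval v f := by
  have : f ∈ LinearMap.ker ((aeval (R := K) (c • v)).toLinearMap -
      c ^ d • (aeval (R := K) v).toLinearMap) := by
    refine homogeneous_mem_of_monomials hf fun m _ hm => ?_
    rw [Finsupp.degree_eq_sum, Fin.sum_univ_three] at hm
    simp only [LinearMap.mem_ker, LinearMap.sub_apply, AlgHom.toLinearMap_apply, map_mul, map_pow,
      aeval_X, LinearMap.smul_apply, Pi.smul_apply, smul_eq_mul, ← hm]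
    ring
  simpa [sub_eq_zero, aeval_eq_eval] using this

theorem eval_smul_eq_zero_iff {d : ℕ} {f : MvPolynomial (Fin 3) K} (hf : f.IsHomogeneous d)
    {c : K} (hc : c ≠ 0) (v : Fin 3 → K) : eval (c • v) f = 0 ↔ eval v f = 0 := by
  rw [eval_smul_of_isHomogeneous hf, mul_eq_zero, or_iff_right (pow_ne_zero _ hc)]

theorem mem_pointIdeal_iff {P : Plane K} {f : MvPolynomial (Fin 3) K} :
    f ∈ pointIdeal P ↔ ∀ c : K, eval (c • P.rep) f = 0 := by
  simp [pointIdeal, mem_vanishingIdeal_iff, P.submodule_eq, Submodule.mem_span_singleton,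
    aeval_eq_eval]

theorem mem_pointIdeal_iff_of_isHomogeneous {d : ℕ} {P : Plane K} {f : MvPolynomial (Fin 3) K}
    (hf : f.IsHomogeneous d) : f ∈ pointIdeal P ↔ eval P.rep f = 0 := by
  rw [mem_pointIdeal_iff]
  refine ⟨fun h => by simpa using h 1, fun h c => ?_⟩
  rw [eval_smul_of_isHomogeneous hf, h, mul_zero]

theorem mem_pointsIdeal_iff_of_isHomogeneous {d : ℕ} {Z : Finset (Plane K)}
    {f : MvPolynomial (Fin 3) K} (hf : f.IsHomogeneous d) :
    f ∈ pointsIdeal Z ↔ ∀ Q ∈ Z, eval Q.rep f = 0 := by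
  simp [pointsIdeal, Submodule.mem_iInf, mem_pointIdeal_iff_of_isHomogeneous hf]

theorem mem_centerIdeal_of_eval [Infinite K] {f : MvPolynomial (Fin 3) K}
    (hf : ∀ c : K, eval ![0, 0, c] f = 0) : f ∈ centerIdeal K := by
  have h1 : aeval (![0, 0, X 2] : Fin 3 → MvPolynomial (Fin 3) K) f = 0 := by
    refine MvPolynomial.funext fun v => ?_
    rw [map_zero, ← hf (v 2), ← coe_aeval_eq_eval, ← coe_aeval_eq_eval]
    change ((aeval v).comp (aeval (![0, 0, X 2] : Fin 3 → MvPolynomial (Fin 3) K))) f = aeval _ f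
    congr 1
    ext i
    fin_cases i <;> simp
  have h2 : (Ideal.Quotient.mkₐ K (centerIdeal K)).comp
      (aeval (![0, 0, X 2] : Fin 3 → MvPolynomial (Fin 3) K)) =
        Ideal.Quotient.mkₐ K (centerIdeal K) := by
    refine MvPolynomial.algHom_ext fun i => ?_
    have h0 : Ideal.Quotient.mk (centerIdeal K) (X 0) = 0 :=
      Ideal.Quotient.eq_zero_iff_mem.2 (Ideal.subset_span (by simp))
    have h1 : Ideal.Quotient.mk (centerIdeal K) (X 1) = 0 :=
      Ideal.Quotient.eq_zero_iff_mem.2 (Ideal.subset_span (by simp))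
    fin_cases i <;> simp [h0, h1]
  have h3 := DFunLike.congr_fun h2 f
  rw [AlgHom.comp_apply, h1, map_zero] at h3
  exact Ideal.Quotient.eq_zero_iff_mem.1 h3.symm

theorem linSubst_mem_centerIdeal_pow [Infinite K] {g : (Fin 3 → K) ≃ₗ[K] (Fin 3 → K)} {P : Plane K}
    (hg : g P.rep = ![0, 0, 1]) {j : ℕ} {f : MvPolynomial (Fin 3) K} (hf : f ∈ pointIdeal P ^ j) :
    linSubst g.symm.toLinearMap f ∈ centerIdeal K ^ j := by
  have hle : (pointIdeal P).map (linSubst g.symm.toLinearMap) ≤ centerIdeal K := by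
    refine Ideal.map_le_iff_le_comap.2 fun f hf => mem_centerIdeal_of_eval fun c => ?_
    have h : (![0, 0, c] : Fin 3 → K) = g (c • P.rep) := by
      rw [map_smul, hg]
      ext i
      fin_cases i <;> simp
    rw [h, eval_linSubst]
    simpa using mem_pointIdeal_iff.1 hf c
  have := Ideal.mem_map_of_mem (linSubst g.symm.toLinearMap) hf
  rw [Ideal.map_pow] at this
  exact Ideal.pow_right_mono hle j this

theorem linSubst_mem_pointIdeal_pow {g : (Fin 3 → K) ≃ₗ[K] (Fin 3 → K)} {P : Plane K}
    (hg : g P.rep = ![0, 0, 1]) {j : ℕ} {f : MvPolynomial (Fin 3) K} (hf : f ∈ centerIdeal K ^ j) :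
    linSubst g.toLinearMap f ∈ pointIdeal P ^ j := by
  have hle : (centerIdeal K).map (linSubst g.toLinearMap) ≤ pointIdeal P := by
    rw [Ideal.map_le_iff_le_comap, centerIdeal, Ideal.span_le]
    rintro f hf
    refine mem_pointIdeal_iff.2 fun c => ?_
    have h : g.toLinearMap (c • P.rep) = c • ![0, 0, 1] := by simp [hg]
    rw [eval_linSubst, h]
    rcases hf with rfl | rfl <;> simp
  have := Ideal.mem_map_of_mem (linSubst g.toLinearMap) hf
  rw [Ideal.map_pow] at this
  exact Ideal.pow_right_mono hle j this

/-- There are linear coordinates in which a given point is `(0 : 0 : 1)` and finitely many others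
lie in the chart where the first coordinate does not vanish. -/
theorem exists_coordinates [Infinite K] {ι : Type*} [Finite ι] {p : Fin 3 → K} (hp : p ≠ 0)
    {v : ι → Fin 3 → K} (hv : ∀ i, v i ∉ K ∙ p) :
    ∃ g : (Fin 3 → K) ≃ₗ[K] (Fin 3 → K), g p = ![0, 0, 1] ∧ ∀ i, g (v i) 0 ≠ 0 := by
  obtain ⟨u, hu⟩ := exists_linearIndependent_pair_of_one_lt_finrank (R := K) (by simp) hp
  obtain ⟨w, hw⟩ := exists_linearIndependent_cons_of_lt_finrank hu (by simp)
  have hu' : u ∉ K ∙ p := by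
    intro h
    obtain ⟨a, ha⟩ := Submodule.mem_span_singleton.1 h
    exact (LinearIndependent.pair_iff' hp).1 hu a ha
  -- a functional vanishing at `p`, but not at `u` and the given vectors
  obtain ⟨x, hxp, hx⟩ := Module.Dual.exists_forall_mem_ne_zero_of_forall_exists
    (LinearMap.ker (Module.Dual.eval K (Fin 3 → K) p))
    (fun i : Option ι => Module.Dual.eval K (Fin 3 → K) (i.elim u v)) (by
      intro i
      have hi : i.elim u v ∉ K ∙ p := by cases i <;> simp only [Option.elim, hu', hv, not_false_iff]
      obtain ⟨f, hf, hle⟩ := Submodule.exists_le_ker_of_notMem hi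
      exact ⟨f, hle (Submodule.mem_span_singleton_self p), hf⟩)
  have hxp' : x p = 0 := hxp
  have hxu : x u ≠ 0 := hx none
  let b := basisOfLinearIndependentOfCardEqFinrank hw (by simp)
  have hb0 : b 0 = w := by simp [b]
  have hb1 : b 1 = p := by simp [b]
  have hb2 : b 2 = u := by simp [b]
  have hinj : Function.Injective (LinearMap.pi ![x, b.coord 0, b.coord 1]) := by
    refine LinearMap.ker_eq_bot.1 ((Submodule.eq_bot_iff _).2 fun y hy => ?_)
    have h0 : x y = 0 := congrFun hy 0
    have h1 : b.repr y 0 = 0 := congrFun hy 1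
    have h2 : b.repr y 1 = 0 := congrFun hy 2
    have hsum := b.sum_repr y
    rw [Fin.sum_univ_three, h1, h2, zero_smul, zero_smul, zero_add, zero_add, hb2] at hsum
    rw [← hsum, map_smul, smul_eq_mul] at h0
    rw [← hsum, (mul_eq_zero.1 h0).resolve_right hxu, zero_smul]
  refine ⟨LinearEquiv.ofInjectiveEndo _ hinj, ?_, fun i => hx (some i)⟩
  ext i
  fin_cases i
  · exact hxp'
  · simp [← hb1]
  · simp [← hb1]

end Coordinates

/-! ### General points and projection from them -/

section GeneralPoint

open MvPolynomial

variable {K : Type*} [Field K]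

/-- A nonzero form over an infinite field does not vanish at all points of the plane. -/
theorem exists_plane_eval_ne_zero [Infinite K] {n : ℕ} {f : MvPolynomial (Fin 3) K}
    (hf : f.IsHomogeneous n) (h0 : f ≠ 0) : ∃ P : Plane K, eval P.rep f ≠ 0 := by
  -- the factor `X 0` makes sure that the vector found below is not zero
  obtain ⟨v, hv⟩ : ∃ v, eval v (X 0 * f) ≠ 0 := by
    by_contra! h
    exact mul_ne_zero (X_ne_zero 0) h0 (MvPolynomial.funext fun v => by rw [h v, map_zero])
  rw [map_mul, eval_X] at hv
  have hv0 : v ≠ 0 := by rintro rfl; simp at hv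
  refine ⟨Projectivization.mk K v hv0, ?_⟩
  obtain ⟨a, ha⟩ := Projectivization.exists_smul_eq_mk_rep K v hv0
  rw [← ha, Units.smul_def, Ne, eval_smul_eq_zero_iff hf a.ne_zero]
  exact right_ne_zero_of_mul hv

theorem forGeneral_of_eval_ne_zero [Infinite K] {n : ℕ} {f : MvPolynomial (Fin 3) K}
    (hf : f.IsHomogeneous n) (h0 : f ≠ 0) {p : Plane K → Prop}
    (h : ∀ P : Plane K, eval P.rep f ≠ 0 → p P) : ForGeneral p := by
  obtain ⟨P, hP⟩ := exists_plane_eval_ne_zero hf h0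
  refine ⟨{P | ∃ g ∈ ({f} : Set (MvPolynomial (Fin 3) K)), eval P.rep g ≠ 0},
    ⟨{f}, by rintro _ rfl; exact ⟨n, hf⟩, rfl⟩, ⟨P, f, rfl, hP⟩, ?_⟩
  rintro Q ⟨g, hg, hQ⟩
  rw [Set.mem_singleton_iff.1 hg] at hQ
  exact h Q hQ

theorem ForGeneral.mono {p q : Plane K → Prop} (hp : ForGeneral p) (h : ∀ P, p P → q P) :
    ForGeneral q := by
  obtain ⟨U, hU, hne, hp⟩ := hp
  exact ⟨U, hU, hne, fun P hP => h P (hp P hP)⟩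

/-- Nonempty open subsets of the plane over an infinite field meet. -/
theorem ForGeneral.and [Infinite K] {p q : Plane K → Prop} (hp : ForGeneral p)
    (hq : ForGeneral q) : ForGeneral fun P => p P ∧ q P := by
  obtain ⟨_, ⟨S, hS, rfl⟩, ⟨P, f, hf, hPf⟩, hp⟩ := hp
  obtain ⟨_, ⟨T, hT, rfl⟩, ⟨Q, g, hg, hQg⟩, hq⟩ := hq
  obtain ⟨m, hm⟩ := hS f hf
  obtain ⟨n, hn⟩ := hT g hg
  refine forGeneral_of_eval_ne_zero (hm.mul hn) (mul_ne_zero ?_ ?_) fun R hR => ?_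
  · rintro rfl; simp at hPf
  · rintro rfl; simp at hQg
  · rw [map_mul] at hR
    exact ⟨hp R ⟨f, hf, left_ne_zero_of_mul hR⟩, hq R ⟨g, hg, right_ne_zero_of_mul hR⟩⟩

theorem ForGeneral.exists {p : Plane K → Prop} (hp : ForGeneral p) : ∃ P, p P := by
  obtain ⟨U, _, ⟨P, hP⟩, h⟩ := hp
  exact ⟨P, h P hP⟩

theorem forGeneral_of_forall [Infinite K] {p : Plane K → Prop} (h : ∀ P, p P) : ForGeneral p :=
  forGeneral_of_eval_ne_zero (isHomogeneous_one _ _) one_ne_zero fun P _ => h P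

theorem forGeneral_forall [Infinite K] {α : Type*} [Finite α] {p : α → Plane K → Prop}
    (h : ∀ a, ForGeneral (p a)) : ForGeneral fun P => ∀ a, p a P := by
  classical
  have := Fintype.ofFinite α
  have key : ∀ s : Finset α, ForGeneral fun P => ∀ a ∈ s, p a P := by
    intro s
    induction s using Finset.induction_on with
    | empty => exact forGeneral_of_forall fun P a ha => absurd ha (Finset.notMem_empty a)
    | insert a s _ ih =>
      exact ((h a).and ih).mono fun P hP => by simpa using hP
  exact (key Finset.univ).mono fun P hP a => hP a (Finset.mem_univ a)

/-- The linear form `v ↦ w ⬝ᵥ v`. -/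
def linearForm (w : Fin 3 → K) : MvPolynomial (Fin 3) K := ∑ i, C (w i) * X i

theorem linearForm_isHomogeneous (w : Fin 3 → K) : (linearForm w).IsHomogeneous 1 :=
  IsHomogeneous.sum _ _ _ fun i _ => (isHomogeneous_X K i).C_mul _

theorem eval_linearForm (w v : Fin 3 → K) : eval v (linearForm w) = w ⬝ᵥ v := by
  simp [linearForm, dotProduct]

theorem linearForm_ne_zero {w : Fin 3 → K} (hw : w ≠ 0) : linearForm w ≠ 0 := by
  intro h
  refine hw (funext fun i => ?_)
  have := eval_linearForm w (Pi.single i 1)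
  rw [h, map_zero, dotProduct_single_one] at this
  exact this.symm

/-- The conditions on the point `P` that make it sufficiently general for `Z`: it is not in `Z`, on
no line through two points of `Z`, and, for each subset of `Z` contained in a conic, off one of the
conics containing the subset. -/
structure GeneralPosition (Z : Finset (Plane K)) (P : Plane K) : Prop where
  notMem_span : ∀ Q : Z, (Q : Plane K).rep ∉ K ∙ P.rep
  not_collinear : ∀ Q Q' : Z, Q ≠ Q' →
    crossProduct (Q : Plane K).rep (Q' : Plane K).rep ⬝ᵥ P.rep ≠ 0
  conic : ∀ s : Finset Z,
    (∃ q : MvPolynomial (Fin 3) K, q.IsHomogeneous 2 ∧ q ≠ 0 ∧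
      ∀ Q ∈ s, eval (Q : Plane K).rep q = 0) →
    ∃ q : MvPolynomial (Fin 3) K, q.IsHomogeneous 2 ∧ (∀ Q ∈ s, eval (Q : Plane K).rep q = 0) ∧
      eval P.rep q ≠ 0

theorem exists_dotProduct_eq_zero (v : Fin 3 → K) : ∃ w : Fin 3 → K, w ≠ 0 ∧ w ⬝ᵥ v = 0 := by
  by_cases h : v 0 = 0
  · exact ⟨Pi.single 0 1, by simp, by simp [h]⟩
  · refine ⟨![-v 1, v 0, 0], fun h0 => h (by simpa using congrFun h0 1), ?_⟩
    simp [dotProduct, Fin.sum_univ_three, mul_comm]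

theorem forGeneral_generalPosition [Infinite K] (Z : Finset (Plane K)) :
    ForGeneral (GeneralPosition Z) := by
  have h1 : ForGeneral fun P : Plane K => ∀ Q : Z, (Q : Plane K).rep ∉ K ∙ P.rep := by
    refine forGeneral_forall fun Q => ?_
    obtain ⟨w, hw, hwQ⟩ := exists_dotProduct_eq_zero (Q : Plane K).rep
    refine forGeneral_of_eval_ne_zero (linearForm_isHomogeneous w) (linearForm_ne_zero hw) ?_
    intro P hP hQP
    obtain ⟨a, ha⟩ := Submodule.mem_span_singleton.1 hQP
    rw [eval_linearForm] at hP
    rw [← ha, dotProduct_smul, smul_eq_mul, mul_eq_zero, or_iff_left hP] at hwQ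
    rw [hwQ, zero_smul] at ha
    exact (Q : Plane K).rep_nonzero ha.symm
  have h2 : ForGeneral fun P : Plane K => ∀ Q Q' : Z, Q ≠ Q' →
      crossProduct (Q : Plane K).rep (Q' : Plane K).rep ⬝ᵥ P.rep ≠ 0 := by
    refine forGeneral_forall fun Q => forGeneral_forall fun Q' => ?_
    by_cases hQ : Q = Q'
    · exact forGeneral_of_forall fun P h => absurd hQ h
    · refine forGeneral_of_eval_ne_zero (linearForm_isHomogeneous _)
        (linearForm_ne_zero (crossProduct_ne_zero_iff_linearIndependent.2
          (Projectivization.linearIndependent_pair_iff_ne.2 fun h => hQ (Subtype.ext h))))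
        fun P hP _ => ?_
      rwa [eval_linearForm] at hP
  have h3 : ForGeneral fun P : Plane K => ∀ s : Finset Z,
      (∃ q : MvPolynomial (Fin 3) K, q.IsHomogeneous 2 ∧ q ≠ 0 ∧
        ∀ Q ∈ s, eval (Q : Plane K).rep q = 0) →
      ∃ q : MvPolynomial (Fin 3) K, q.IsHomogeneous 2 ∧
        (∀ Q ∈ s, eval (Q : Plane K).rep q = 0) ∧ eval P.rep q ≠ 0 := by
    refine forGeneral_forall fun s => ?_
    by_cases hs : ∃ q : MvPolynomial (Fin 3) K, q.IsHomogeneous 2 ∧ q ≠ 0 ∧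
        ∀ Q ∈ s, eval (Q : Plane K).rep q = 0
    · obtain ⟨q, hq, hq0, hqs⟩ := hs
      exact forGeneral_of_eval_ne_zero hq hq0 fun P hP _ => ⟨q, hq, hqs, hP⟩
    · exact forGeneral_of_forall fun P h => absurd h hs
  exact ((h1.and h2).and h3).mono fun P h => ⟨h.1.1, h.1.2, h.2⟩

theorem hilbertFn_add_dimDeg (Z : Finset (Plane K)) (d : ℕ) :
    hilbertFn Z d + dimDeg (pointsIdeal Z) d = (d + 2).choose 2 := by
  have h := LinearMap.finrank_range_add_finrank_ker
    ((Ideal.Quotient.mkₐ K (pointsIdeal Z)).toLinearMap.domRestrict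
      (homogeneousSubmodule (Fin 3) K d))
  rw [finrank_homogeneousSubmodule, LinearMap.range_domRestrict] at h
  have hker : (LinearMap.ker ((Ideal.Quotient.mkₐ K (pointsIdeal Z)).toLinearMap.domRestrict
      (homogeneousSubmodule (Fin 3) K d))).map (homogeneousSubmodule (Fin 3) K d).subtype =
        homogeneousSubmodule (Fin 3) K d ⊓ (pointsIdeal Z).restrictScalars K := by
    ext f
    simp [Ideal.Quotient.eq_zero_iff_mem, and_comm]
  rw [← h, hilbertFn, dimDeg, ← hker, Submodule.finrank_map_subtype_eq]

/-- Projection from a general point `P`: in suitable coordinates the points of `Z` are `(1, y, z)`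
with distinct values of `y`, the point `P` is `(0, 0, 1)`, and the dimensions in question are
determined by the values of polynomials in `y` and `z`. -/
theorem GeneralPosition.exists_affine [Infinite K] {Z : Finset (Plane K)} {P : Plane K}
    (h : GeneralPosition Z P) : ∃ y z : Z → K, Function.Injective y ∧ AvoidsConics y z ∧
      (∀ d, dimDeg (pointsIdeal Z) d + Module.finrank K (evalSpan y z d) = (d + 2).choose 2) ∧
      ∀ j, dimDeg (fatIdeal Z j P) (j + 1) =
        Module.finrank K (LinearMap.ker (pencilEval y z (j + 1))) := by
  obtain ⟨g, hg, hgQ⟩ := exists_coordinates P.rep_nonzero h.notMem_span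
  set a : Z → K := fun Q => (g (Q : Plane K).rep 0)⁻¹ with ha
  have ha0 : ∀ Q, a Q ≠ 0 := fun Q => inv_ne_zero (hgQ Q)
  set y : Z → K := fun Q => a Q * g (Q : Plane K).rep 1 with hy
  set z : Z → K := fun Q => a Q * g (Q : Plane K).rep 2 with hz
  have hgv : ∀ Q : Z, g (a Q • (Q : Plane K).rep) = ![1, y Q, z Q] := by
    intro Q
    rw [map_smul]
    ext i
    fin_cases i
    · simp [ha, inv_mul_cancel₀ (hgQ Q)]
    · simp [hy]
    · simp [hz]
  -- vanishing at a point of `Z`, in the new coordinates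
  have hvan : ∀ {d : ℕ} {f : MvPolynomial (Fin 3) K}, f.IsHomogeneous d → ∀ Q : Z,
      (eval ![1, y Q, z Q] f = 0 ↔ eval (Q : Plane K).rep (linSubst g.toLinearMap f) = 0) := by
    intro d f hf Q
    rw [← eval_smul_eq_zero_iff (linSubst_isHomogeneous _ hf) (ha0 Q), eval_linSubst, ← hgv]
    rfl
  have hsymm := linSubst_linSubst_symm g
  refine ⟨y, z, ?_, ?_, ?_, ?_⟩
  · intro Q Q' hQ
    by_contra hne
    have h1 : a Q • (Q : Plane K).rep - a Q' • (Q' : Plane K).rep = (z Q - z Q') • P.rep := by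
      apply g.injective
      rw [map_sub, hgv, hgv, map_smul, hg]
      ext i
      fin_cases i <;> simp [hQ]
    have h2 := congrArg (crossProduct (Q : Plane K).rep (Q' : Plane K).rep ⬝ᵥ ·) h1
    simp only [dotProduct_sub, dotProduct_smul] at h2
    rw [dotProduct_comm _ (Q : Plane K).rep, dotProduct_comm _ (Q' : Plane K).rep,
      dot_self_cross, dot_cross_self, smul_zero, smul_zero, sub_zero, smul_eq_mul, eq_comm,
      mul_eq_zero, or_iff_left (h.not_collinear Q Q' hne)] at h2
    rw [h2, zero_smul, sub_eq_zero] at h1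
    have h3 := (LinearIndependent.pair_iff.1 (Projectivization.linearIndependent_pair_iff_ne.2
      fun h => hne (Subtype.ext h))) (a Q) (-a Q') (by rw [h1, neg_smul, add_neg_cancel])
    exact ha0 Q h3.1
  · rintro s ⟨c, U, V, ⟨hU, hV, hUV⟩, hne⟩
    have hdeg : ∀ {p : Polynomial K} {d : ℕ}, p.natDegree ≤ d → p ∈ Polynomial.degreeLT K (d + 1) :=
      fun {p d} hp => Polynomial.mem_degreeLT.2
        (Polynomial.degree_le_natDegree.trans_lt (by exact_mod_cast Nat.lt_succ_of_le hp))
    set q := conicForm (c, ⟨U, hdeg hU⟩, ⟨V, hdeg hV⟩) with hq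
    have hqhom : q.IsHomogeneous 2 := range_conicForm.le ⟨_, hq.symm⟩
    have hqe : ∀ y z, eval ![1, y, z] q = c * z ^ 2 + U.eval y * z + V.eval y :=
      fun y z => eval_conicForm _ y z
    have hq0 : linSubst g.toLinearMap q ≠ 0 := by
      intro h0
      have := eq_zero_of_forall_conic_eq_zero (c := c) (U := U) (V := V) fun y z => by
        have h1 := congrArg (eval (g.symm ![1, y, z])) h0
        rw [eval_linSubst, map_zero] at h1
        rw [← hqe y z, ← h1]
        simp
      simp [this] at hne
    obtain ⟨q', hq', hqs, hqP⟩ := h.conic s ⟨linSubst g.toLinearMap q,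
      linSubst_isHomogeneous _ hqhom, hq0, fun Q hQ => by
        rw [← hvan hqhom, hqe]
        exact hUV Q hQ⟩
    obtain ⟨⟨c', U', V'⟩, hp⟩ : linSubst g.symm.toLinearMap q' ∈ LinearMap.range conicForm := by
      rw [range_conicForm]
      exact linSubst_isHomogeneous _ hq'
    refine ⟨c', U', V', ⟨natDegree_le_of_mem_degreeLT U'.2, natDegree_le_of_mem_degreeLT V'.2,
      fun Q hQ => ?_⟩, ?_⟩
    · have := eval_conicForm (c', U', V') (y Q) (z Q)
      rw [← this, hp, hvan (linSubst_isHomogeneous _ hq'), hsymm]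
      exact hqs Q hQ
    · have := eval_conicForm_center (c', U', V')
      rw [hp, eval_linSubst, ← hg] at this
      simp only [LinearEquiv.coe_coe, LinearEquiv.symm_apply_apply] at this
      rwa [← this]
  · intro d
    -- evaluation of forms of degree `d` at the chosen representatives
    let ev : homogeneousSubmodule (Fin 3) K d →ₗ[K] (Z → K) :=
      (LinearMap.pi fun Q : Z => (aeval (R := K) (g.symm ![1, y Q, z Q])).toLinearMap) ∘ₗ
        (homogeneousSubmodule (Fin 3) K d).subtype
    have hev : ∀ f Q, ev f Q = eval (g.symm ![1, y Q, z Q]) (f : MvPolynomial (Fin 3) K) :=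
      fun f Q => by simp [ev, aeval_eq_eval]
    have hker : (LinearMap.ker ev).map (homogeneousSubmodule (Fin 3) K d).subtype =
        homogeneousSubmodule (Fin 3) K d ⊓ (pointsIdeal Z).restrictScalars K := by
      ext f
      simp only [Submodule.mem_map, LinearMap.mem_ker, Submodule.subtype_apply, Subtype.exists,
        exists_and_right, exists_eq_right, Submodule.mem_inf, Submodule.restrictScalars_mem]
      refine ⟨fun ⟨hf, h0⟩ => ⟨hf, (mem_pointsIdeal_iff_of_isHomogeneous hf).2 fun Q hQ => ?_⟩,
        fun ⟨hf, h0⟩ => ⟨hf, funext fun Q => ?_⟩⟩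
      · have := congrFun h0 ⟨Q, hQ⟩
        rw [hev, ← hgv, LinearEquiv.symm_apply_apply] at this
        exact (eval_smul_eq_zero_iff hf (ha0 _) _).1 this
      · rw [hev, ← hgv, LinearEquiv.symm_apply_apply]
        exact (eval_smul_eq_zero_iff hf (ha0 _) _).2
          ((mem_pointsIdeal_iff_of_isHomogeneous hf).1 h0 Q Q.2)
    have hrange : LinearMap.range ev = evalSpan y z d := by
      refine le_antisymm ?_ (Submodule.span_le.2 ?_)
      · rintro _ ⟨⟨f, hf⟩, rfl⟩
        have : linSubst g.symm.toLinearMap f ∈ (evalSpan y z d).comap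
            (LinearMap.pi fun Q : Z => (aeval (R := K) ![1, y Q, z Q]).toLinearMap) := by
          refine homogeneous_mem_of_monomials (linSubst_isHomogeneous _ hf) fun m _ hm => ?_
          rw [Finsupp.degree_eq_sum, Fin.sum_univ_three] at hm
          have := mem_evalSpan_monomial y z (a := m 1) (b := m 2) (d := d) (by omega)
          rw [Submodule.mem_comap]
          convert this using 1
          funext Q
          simp
        rw [Submodule.mem_comap] at this
        convert this using 1
        funext Q
        rw [hev]
        simp [aeval_eq_eval, eval_linSubst]
      · rintro _ ⟨m, n, hmn, rfl⟩
        have hhom : (X 0 ^ (d - m - n) * X 1 ^ m * X 2 ^ n : MvPolynomial (Fin 3) K).IsHomogeneous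
            d := by
          have := ((isHomogeneous_X_pow (R := K) (0 : Fin 3) (d - m - n)).mul
            (isHomogeneous_X_pow (R := K) (1 : Fin 3) m)).mul
            (isHomogeneous_X_pow (R := K) (2 : Fin 3) n)
          rwa [show d - m - n + m + n = d by omega] at this
        refine ⟨⟨_, linSubst_isHomogeneous g.toLinearMap hhom⟩, ?_⟩
        ext Q
        rw [hev, eval_linSubst]
        simp
    rw [dimDeg, ← hker, Submodule.finrank_map_subtype_eq, ← hrange, add_comm,
      LinearMap.finrank_range_add_finrank_ker, finrank_homogeneousSubmodule]
  · intro j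
    have hinj : Function.Injective
        ((linSubst g.toLinearMap).toLinearMap ∘ₗ pencilForm (K := K) j) := by
      refine Function.Injective.comp (g := linSubst g.toLinearMap) ?_ (pencilForm_injective j)
      intro f f' hff
      have h1 := linSubst_linSubst_symm g.symm
      rw [LinearEquiv.symm_symm] at h1
      rw [← h1 f, ← h1 f']
      exact congrArg _ hff
    have hmap : homogeneousSubmodule (Fin 3) K (j + 1) ⊓ (fatIdeal Z j P).restrictScalars K =
        (LinearMap.ker (pencilEval y z (j + 1))).map
          ((linSubst g.toLinearMap).toLinearMap ∘ₗ pencilForm (K := K) j) := by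
      ext f
      constructor
      · rintro ⟨hf, hfP, hfZ⟩
        obtain ⟨p, hp⟩ : linSubst g.symm.toLinearMap f ∈
            LinearMap.range (pencilForm (K := K) j) := by
          rw [range_pencilForm]
          exact ⟨linSubst_isHomogeneous _ hf, linSubst_mem_centerIdeal_pow hg hfP⟩
        refine ⟨p, funext fun Q => ?_, ?_⟩
        · have := eval_pencilForm j p (y Q) (z Q)
          refine this.symm.trans ?_
          rw [hp]
          refine (hvan (linSubst_isHomogeneous _ hf) Q).2 ?_
          rw [hsymm]
          exact (mem_pointsIdeal_iff_of_isHomogeneous hf).1 hfZ Q Q.2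
        · simp [hp, hsymm]
      · rintro ⟨p, hp, rfl⟩
        obtain ⟨h1, h2⟩ := (range_pencilForm (K := K) j).le ⟨p, rfl⟩
        refine ⟨linSubst_isHomogeneous _ h1, linSubst_mem_pointIdeal_pow hg h2,
          (mem_pointsIdeal_iff_of_isHomogeneous (linSubst_isHomogeneous _ h1)).2 fun Q hQ => ?_⟩
        rw [← hvan h1 ⟨Q, hQ⟩, eval_pencilForm]
        exact congrFun hp ⟨Q, hQ⟩
    rw [dimDeg, hmap]
    exact (Submodule.equivMapOfInjective _ hinj _).finrank_eq.symm

end GeneralPoint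

/-! ### The dimensions of the linear systems -/

section Dimensions

variable {K : Type*} [Field K]

theorem choose_add_three (j : ℕ) : (j + 1 + 2).choose 2 = (j + 1).choose 2 + (2 * j + 3) := by
  have h1 : (j + 1 + 2).choose 2 = (j + 2).choose 1 + (j + 2).choose 2 := Nat.choose_succ_succ' _ _
  have h2 : (j + 2).choose 2 = (j + 1).choose 1 + (j + 1).choose 2 := Nat.choose_succ_succ' _ _
  rw [h1, h2, Nat.choose_one_right, Nat.choose_one_right]
  omega

/-- The infimum defining `tIndex` is attained: the set is nonempty since `h(d) ≤ |Z|`. -/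
theorem choose_lt_dimDeg_tIndex [Infinite K] (Z : Finset (Plane K)) :
    (tIndex Z + 1).choose 2 < dimDeg (pointsIdeal Z) (tIndex Z + 1) := by
  refine Nat.sInf_mem (s := {j : ℕ | (j + 1).choose 2 < dimDeg (pointsIdeal Z) (j + 1)}) ?_
  obtain ⟨P, hP⟩ := (forGeneral_generalPosition Z).exists
  obtain ⟨y, z, -, -, hdim, -⟩ := hP.exists_affine
  refine ⟨Z.card, ?_⟩
  have h1 := hdim (Z.card + 1)
  have h2 : Module.finrank K (evalSpan y z (Z.card + 1)) ≤ Z.card := by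
    simpa using Submodule.finrank_le (evalSpan y z (Z.card + 1))
  rw [choose_add_three] at h1
  change (Z.card + 1).choose 2 < dimDeg (pointsIdeal Z) (Z.card + 1)
  omega

theorem dimDeg_le_of_lt_tIndex {Z : Finset (Plane K)} {j : ℕ} (hj : j < tIndex Z) :
    dimDeg (pointsIdeal Z) (j + 1) ≤ (j + 1).choose 2 :=
  not_lt.1 fun h => Nat.notMem_of_lt_sInf hj h

/-- The dimensions of the systems `[I_{Z + jP}]_{j + 1}` for a sufficiently general point `P`. -/
theorem GeneralPosition.dimDeg_fatIdeal [Infinite K] {Z : Finset (Plane K)} {P : Plane K}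
    (h : GeneralPosition Z P) (hZ : hilbertFn Z (tIndex Z) < Z.card) :
    2 * tIndex Z + 1 < Z.card ∧
    dimDeg (pointsIdeal Z) (tIndex Z + 1) = (tIndex Z + 1).choose 2 + 1 ∧
    (∀ j < tIndex Z, dimDeg (fatIdeal Z j P) (j + 1) = 0) ∧
    ∀ j, tIndex Z ≤ j →
      dimDeg (fatIdeal Z j P) (j + 1) + (j + 1).choose 2 = dimDeg (pointsIdeal Z) (j + 1) := by
  obtain ⟨y, z, hy, hconic, hdim, hfat⟩ := h.exists_affine
  have hhilb : ∀ d, hilbertFn Z d = Module.finrank K (evalSpan y z d) := fun d => by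
    have h1 := hilbertFn_add_dimDeg Z d
    have h2 := hdim d
    omega
  have hsucc : ∀ j, dimDeg (pointsIdeal Z) (j + 1) + Module.finrank K (evalSpan y z (j + 1)) =
      (j + 1).choose 2 + (2 * j + 3) := fun j => by rw [hdim, choose_add_three]
  have hcard : Module.finrank K (evalSpan y z (tIndex Z)) < Fintype.card Z := by
    rw [Fintype.card_coe, ← hhilb]
    exact hZ
  obtain ⟨hrank, hrank'⟩ := finrank_evalSpan_eq hy (z := z) (t := tIndex Z)
    (fun j hj => by
      have h1 := hsucc j
      have h2 := dimDeg_le_of_lt_tIndex hj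
      omega)
    (by
      have h1 := hsucc (tIndex Z)
      have h2 := choose_lt_dimDeg_tIndex Z
      omega) hcard
  refine ⟨?_, ?_, fun j hj => ?_, fun j hj => ?_⟩
  · rw [hrank, Fintype.card_coe] at hcard
    exact hcard
  · have h1 := hsucc (tIndex Z)
    omega
  · rw [hfat, ker_pencilEval_eq_bot hy hrank hcard hconic hj, finrank_bot]
  · have h1 := LinearMap.finrank_range_add_finrank_ker (pencilEval y z (j + 1))
    rw [finrank_degreeLT_prod, range_pencilEval_eq hy hrank hrank' hcard hconic (by omega),
      ← hfat] at h1
    have h2 := hsucc j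
    omega

end Dimensions

end UnexpectedCurves

end

theorem theorem4p3 {K : Type*} [Field K] [Infinite K]
    (Z : Finset (UnexpectedCurves.Plane K))
    (hZ : UnexpectedCurves.hilbertFn Z (UnexpectedCurves.tIndex Z) < Z.card) :
    UnexpectedCurves.multIndex Z = UnexpectedCurves.tIndex Z ∧
    (UnexpectedCurves.tIndex Z : ℚ) < ((Z.card : ℚ) - 1) / 2 ∧
    (UnexpectedCurves.ForGeneral fun P : UnexpectedCurves.Plane K =>
      UnexpectedCurves.dimDeg (UnexpectedCurves.fatIdeal Z (UnexpectedCurves.multIndex Z) P)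
        (UnexpectedCurves.multIndex Z + 1) = 1 ∧
      ∀ j : ℕ, UnexpectedCurves.multIndex Z ≤ j →
        (UnexpectedCurves.dimDeg (UnexpectedCurves.fatIdeal Z j P) (j + 1) : ℤ) =
          (UnexpectedCurves.dimDeg (UnexpectedCurves.pointsIdeal Z) (j + 1) : ℤ) -
            ((j + 1).choose 2 : ℤ)) ∧
    ¬ UnexpectedCurves.AdmitsUnexpectedCurve Z := by
  have hgen := UnexpectedCurves.forGeneral_generalPosition Z
  obtain ⟨P₀, hP₀⟩ := hgen.exists
  obtain ⟨hcard, hdim, -, -⟩ := hP₀.dimDeg_fatIdeal hZ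
  have hone : ∀ P, UnexpectedCurves.GeneralPosition Z P → UnexpectedCurves.dimDeg
      (UnexpectedCurves.fatIdeal Z (UnexpectedCurves.tIndex Z) P)
        (UnexpectedCurves.tIndex Z + 1) = 1 := fun P hP => by
    have := (hP.dimDeg_fatIdeal hZ).2.2.2 _ le_rfl
    omega
  have hmult : UnexpectedCurves.multIndex Z = UnexpectedCurves.tIndex Z := by
    refine le_antisymm (Nat.sInf_le ?_) (le_csInf ⟨UnexpectedCurves.tIndex Z, ?_⟩ fun j hj => ?_)
    · exact hgen.mono fun P hP => by rw [hone P hP]; exact one_pos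
    · exact hgen.mono fun P hP => by rw [hone P hP]; exact one_pos
    · by_contra! hlt
      obtain ⟨P, hP, hpos⟩ := (hgen.and hj).exists
      rw [(hP.dimDeg_fatIdeal hZ).2.2.1 j hlt] at hpos
      exact lt_irrefl _ hpos
  refine ⟨hmult, ?_, ?_, ?_⟩
  · have h : (2 * UnexpectedCurves.tIndex Z + 1 : ℚ) < Z.card := by exact_mod_cast hcard
    linarith
  · rw [hmult]
    refine hgen.mono fun P hP => ⟨hone P hP, fun j hj => ?_⟩
    have := (hP.dimDeg_fatIdeal hZ).2.2.2 j hj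
    omega
  · rintro ⟨j, -, hj⟩
    obtain ⟨P, hP, hlt⟩ := (hgen.and hj).exists
    rcases lt_or_ge j (UnexpectedCurves.tIndex Z) with h | h
    · have := (hP.dimDeg_fatIdeal hZ).2.2.1 j h
      omega
    · have := (hP.dimDeg_fatIdeal hZ).2.2.2 j h
      omega
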